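/- Setting. There are finitely many agents $k=1,\dots,K$ and finitely many hypotheses $\Theta=\{1,\dots,H\}$, with true hypothesis $\theta_0\in\Theta$ and transmitted hypothesis $\theta_{\rm TX}\in\Theta$. The matrix $A=[a_{\ell k}]$ is left-stochastic ($a_{\ell k}\ge 0$, $\sum_\ell a_{\ell k}=1$ for each $k$). For each agent $k$ and each $\theta\in\Theta$, $L_{k,\theta}=L_k(\cdot\,|\,\theta)$ is a probability density on the observation space $\mathcal X_k$ with respect to a $\sigma$-finite reference measure (e.g. a probability density function or a probability mass function). At times $i=1,2,\dots$ agent $k$ observes $\boldsymbol\xi_{k,i}\in\mathcal X_k$ with distribution $L_{k,\theta_0}$; the vectors $(\boldsymbol\xi_{1,i},\dots,\boldsymbol\xi_{K,i})$, $i\ge1$, are independent over $i$, with arbitrary dependence across agents. Starting from initial beliefs $\mu_{k,0}$, the agents iterate, for $i=1,2,\dots$, the memory-aware social learning rule with partial information sharing $$\boldsymbol\psi_{k,i}(\theta)=\frac{L_k(\boldsymbol\xi_{k,i}|\theta)\,\boldsymbol\mu_{k,i-1}(\theta)}{\sum_{\tau\in\Theta}L_k(\boldsymbol\xi_{k,i}|\tau)\,\boldsymbol\mu_{k,i-1}(\tau)},\qquad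 \widehat{\boldsymbol\psi}_{\ell k,i}(\theta)=\begin{cases}\boldsymbol\psi_{\ell,i}(\theta_{\rm TX}),&\theta=\theta_{\rm TX},\\[2pt] \dfrac{\boldsymbol\psi_{k,i}(\theta)}{1-\boldsymbol\psi_{k,i}(\theta_{\rm TX})}\bigl(1-\boldsymbol\psi_{\ell,i}(\theta_{\rm TX})\bigr),&\theta\ne\theta_{\rm TX},\end{cases}$$ $$\boldsymbol\mu_{k,i}(\theta)=\frac{\prod_{\ell=1}^K[\widehat{\boldsymbol\psi}_{\ell k,i}(\theta)]^{a_{\ell k}}}{\sum_{\tau\in\Theta}\prod_{\ell=1}^K[\widehat{\boldsymbol\psi}_{\ell k,i}(\tau)]^{a_{\ell k}}}.$$ Let $\mathcal D_k=\{\theta\in\Theta: D_{\rm KL}(L_{k,\theta_0}\|L_{k,\theta})\ne0\}$ be the distinguishable hypotheses of agent $k$, $\mathcal I_k=\{\theta\in\Theta\setminus\{\theta_0\}: D_{\rm KL}(L_{k,\theta_0}\|L_{k,\theta})=0\}$ its indistinguishable ones, and $J_k=|\mathcal I_k|$. Assumptions. (1) The network is strongly connected: for every ordered pair of agents $(\ell,k)$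 there is a path of nonzero weights from $\ell$ to $k$, and $a_{kk}>0$ for at least one $k$. (2) $D_{\rm KL}(L_{k,\theta}\|L_{k,\theta'})<\infty$ for all $k,\theta,\theta'$. (3) The initial beliefs are uniform: $\mu_{k,0}(\theta)=1/H$ for all $k,\theta$. (4) Global identifiability: for each $\theta\ne\theta_0$ there is an agent $k$ with $\theta\in\mathcal D_k$. (5) For each agent with $\mathcal D_k\ne\emptyset$, the distribution $L_{k,\theta_0}$ is not a convex combination of the distributions $L_{k,\theta}$, $\theta\in\mathcal D_k$. Claim. There is a unique vector $v$ (the Perron eigenvector) with $Av=v$, $\sum_k v_k=1$ and $v_k>0$ for all $k$. Let $J=\prod_{k=1}^K J_k^{v_k}$. All the following convergences are almost sure as $i\to\infty$, and hold for every agent $k$. If $\theta_{\rm TX}\ne\theta_0$: - $\boldsymbol\mu_{k,i}(\theta_{\rm TX})\to0$; - $\boldsymbol\mu_{k,i}(\theta)\to0$ for every $\theta\in\mathcal D_k\setminus\{\theta_{\rm TX}\}$; - $\boldsymbol\mu_{k,i}(\theta)\to 1/|\mathcal I_{k,\overline{\rm TX}}|$ for every $\theta\in\mathcal I_{k,\overline{\rm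 TX}}:=\{\theta_0\}\cup(\mathcal I_k\setminus\{\theta_{\rm TX}\})$. If $\theta_{\rm TX}=\theta_0$: - $\boldsymbol\mu_{k,i}(\theta_0)\to\dfrac1{1+J}$; - $\boldsymbol\mu_{k,i}(\theta)\to0$ for every $\theta\in\mathcal D_k$; - $\boldsymbol\mu_{k,i}(\theta)\to\dfrac{J}{J_k}\cdot\dfrac1{1+J}$ for every $\theta\in\mathcal I_k$. -/

import Mathlib

open MeasureTheory ProbabilityTheory Filter Topology

/-! ### Network -/

/-- `A ℓ k` is the weight that agent `k` gives to agent `ℓ`. `A` is left-stochastic: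
entries are nonnegative and every column sums to one. -/
def IsLeftStochastic {K : ℕ} (A : Matrix (Fin K) (Fin K) ℝ) : Prop :=
  (∀ ℓ k, 0 ≤ A ℓ k) ∧ ∀ k, ∑ ℓ, A ℓ k = 1

/-- Any agent can be reached from any other along edges of nonzero weight, and at least one
agent has a positive self-weight. -/
def IsStronglyConnected {K : ℕ} (A : Matrix (Fin K) (Fin K) ℝ) : Prop :=
  (∀ ℓ k, Relation.ReflTransGen (fun a b => A a b ≠ 0) ℓ k) ∧ ∃ k, 0 < A k k

/-- `v` is a Perron eigenvector of `A`: `A v = v`, the entries of `v` add up to one and all of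
them are positive. -/
def IsPerronVector {K : ℕ} (A : Matrix (Fin K) (Fin K) ℝ) (v : Fin K → ℝ) : Prop :=
  A.mulVec v = v ∧ ∑ k, v k = 1 ∧ ∀ k, 0 < v k

/-! ### The memory-aware social learning algorithm with partial information -/

/-- Local Bayesian update of the belief `μ`, where `l θ` is the likelihood of `θ` at the current
observation; it is normalized to total mass one. -/
noncomputable def bayesUpdate {H : ℕ} (l μ : Fin H → ℝ) (θ : Fin H) : ℝ :=
  l θ * μ θ / ∑ τ, l τ * μ τ

/-- Memory-aware filling: an agent with intermediate belief `ψ` that receives the single number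
`s` (the intermediate belief of a neighbor in the transmitted hypothesis `θTX`) completes it to a
whole belief vector, sharing the residual mass `1 - s` in proportion to `ψ`. -/
noncomputable def memoryAwareFill {H : ℕ} (θTX : Fin H) (ψ : Fin H → ℝ) (s : ℝ) (θ : Fin H) : ℝ :=
  if θ = θTX then s else ψ θ / (1 - ψ θTX) * (1 - s)

/-- Normalized weighted geometric average of the belief vectors `q ℓ` with weights `w ℓ`
(agents that are not neighbors have weight zero and contribute the factor `1`). -/
noncomputable def geometricCombine {K H : ℕ} (w : Fin K → ℝ) (q : Fin K → Fin H → ℝ)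
    (θ : Fin H) : ℝ :=
  (∏ ℓ, q ℓ θ ^ w ℓ) / ∑ τ, ∏ ℓ, q ℓ τ ^ w ℓ

/-- One iteration: from the beliefs `μ` of all agents and the likelihoods `l k θ` of their current
observations to the new beliefs of all agents. -/
noncomputable def beliefStep {K H : ℕ} (A : Matrix (Fin K) (Fin K) ℝ) (θTX : Fin H)
    (l μ : Fin K → Fin H → ℝ) (k : Fin K) : Fin H → ℝ :=
  geometricCombine (fun ℓ => A ℓ k) fun ℓ =>
    memoryAwareFill θTX (bayesUpdate (l k) (μ k)) (bayesUpdate (l ℓ) (μ ℓ) θTX)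

/-- The beliefs `belief A L θTX μ₀ x i k θ` of agent `k` in hypothesis `θ` at time `i`, started
from the initial beliefs `μ₀`. Here `L k θ` is the likelihood model of agent `k` under `θ`, and
`x k i` is the observation which agent `k` receives at time `i + 1`. -/
noncomputable def belief {K H : ℕ} {X : Fin K → Type*} (A : Matrix (Fin K) (Fin K) ℝ)
    (L : (k : Fin K) → Fin H → X k → ℝ) (θTX : Fin H) (μ₀ : Fin K → Fin H → ℝ)
    (x : (k : Fin K) → ℕ → X k) : ℕ → Fin K → Fin H → ℝ
  | 0 => μ₀
  | i + 1 => beliefStep A θTX (fun k θ => L k θ (x k i)) (belief A L θTX μ₀ x i)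

/-! ### Likelihood models

The models of one agent: `f θ` is the probability density (or mass function) of its observations
under the hypothesis `θ`, with respect to a reference measure `ν`. -/

/-- Every `f θ` is a probability density with respect to `ν`. -/
def IsDensityFamily {H : ℕ} {X : Type*} [MeasurableSpace X] (ν : Measure X)
    (f : Fin H → X → ℝ) : Prop :=
  ∀ θ, Measurable (f θ) ∧ (∀ x, 0 ≤ f θ x) ∧ ∫⁻ x, ENNReal.ofReal (f θ x) ∂ν = 1

/-- The distribution with density `g` with respect to `ν`. -/
noncomputable def densityLaw {X : Type*} [MeasurableSpace X] (ν : Measure X)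
    (g : X → ℝ) : Measure X :=
  ν.withDensity fun x => ENNReal.ofReal (g x)

open Classical in
/-- The hypotheses that the agent can distinguish from `θ₀`. -/
noncomputable def distinguishable {H : ℕ} {X : Type*} [MeasurableSpace X] (ν : Measure X)
    (f : Fin H → X → ℝ) (θ₀ : Fin H) : Finset (Fin H) :=
  {θ | InformationTheory.klDiv (densityLaw ν (f θ₀)) (densityLaw ν (f θ)) ≠ 0}

open Classical in
/-- The hypotheses, other than `θ₀`, that the agent cannot distinguish from `θ₀`. -/
noncomputable def indistinguishable {H : ℕ} {X : Type*} [MeasurableSpace X] (ν : Measure X)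
    (f : Fin H → X → ℝ) (θ₀ : Fin H) : Finset (Fin H) :=
  {θ | θ ≠ θ₀ ∧ InformationTheory.klDiv (densityLaw ν (f θ₀)) (densityLaw ν (f θ)) = 0}

/-- If the set of distinguishable hypotheses is nonempty, then the true model is not a convex
combination of the distinguishable ones. Densities are identified when they are equal almost
everywhere, that is, when they define the same distribution. -/
def TrueModelNotMixture {H : ℕ} {X : Type*} [MeasurableSpace X] (ν : Measure X)
    (f : Fin H → X → ℝ) (θ₀ : Fin H) : Prop :=
  (distinguishable ν f θ₀).Nonempty →
    ∀ α : Fin H → ℝ, (∀ θ ∈ distinguishable ν f θ₀, 0 ≤ α θ) →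
      ∑ θ ∈ distinguishable ν f θ₀, α θ = 1 →
        ¬ f θ₀ =ᵐ[ν] fun x => ∑ θ ∈ distinguishable ν f θ₀, α θ * f θ x

/-- The weighted geometric average `∏ₖ |Iₖ| ^ vₖ` of the numbers of indistinguishable
hypotheses. -/
noncomputable def confusionAverage {K H : ℕ} (I : Fin K → Finset (Fin H)) (v : Fin K → ℝ) : ℝ :=
  ∏ k, ((I k).card : ℝ) ^ v k

/-! ### Stochastic matrices -/

/-! Write `T` for the transmitted hypothesis. The memory-aware rule splits each belief vector into
two pieces that evolve separately. Every vector that agent `k` combines shares its residual mass in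
proportion to `k`'s own intermediate belief, and the weights sum to one. Hence the proportions among
the hypotheses other than `T` are those of `k`'s own cumulated likelihoods, exactly, at all times.
Only one number is influenced by the network, the log-odds of `T`, and it obeys a linear recursion:
with `S i` the log-ratio of the likelihood of `T` to the sum of the other likelihoods, `y (i + 1) =
(y i + S (i + 1) - S i) A` (`belief_eq_oddsBelief`).

Such a diffusion conserves the Perron average, and `A` contracts deviations from it in an adapted
norm. So `y i` follows the average of `S i` under `v`, up to an error governed by the increments of
`S` (`IsPerronVector.tendsto_diffusion`).

Probability enters only through `ae_isTypical`: by the strong law, a likelihood ratio against `θ₀`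
decays exponentially for a distinguishable hypothesis and is identically one for an
indistinguishable one. If `T ≠ θ₀`, the sum in `S` contains `θ₀`, so `S` has slope minus the
divergence of `T`, the Perron average of the slopes is negative and the odds vanish. If `T = θ₀` and
no `J_k` is zero, `S` tends to `-log J_k` at each agent, so the odds tend to `1 / J`. If some `J_k`
is zero, `S` grows linearly there and drives all odds to infinity, which agrees with `J = 0`. -/

theorem IsLeftStochastic.mem_colStochastic {K : ℕ} {A : Matrix (Fin K) (Fin K) ℝ}
    (hA : IsLeftStochastic A) : A ∈ Matrix.colStochastic ℝ (Fin K) :=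
  Matrix.mem_colStochastic_iff_sum.2 hA

theorem IsLeftStochastic.pow {K : ℕ} {A : Matrix (Fin K) (Fin K) ℝ}
    (hA : IsLeftStochastic A) (n : ℕ) : IsLeftStochastic (A ^ n) :=
  Matrix.mem_colStochastic_iff_sum.1 (pow_mem hA.mem_colStochastic n)

theorem IsLeftStochastic.pow_add_pos {K : ℕ} {A : Matrix (Fin K) (Fin K) ℝ}
    (hA : IsLeftStochastic A) {m n : ℕ} {a b c : Fin K} (h₁ : 0 < (A ^ m) a b)
    (h₂ : 0 < (A ^ n) b c) : 0 < (A ^ (m + n)) a c := by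
  rw [pow_add, Matrix.mul_apply]
  exact (mul_pos h₁ h₂).trans_le (Finset.single_le_sum
    (f := fun j => (A ^ m) a j * (A ^ n) j c)
    (fun j _ => mul_nonneg ((hA.pow m).1 a j) ((hA.pow n).1 j c)) (Finset.mem_univ b))

theorem IsLeftStochastic.exists_pow_pos_of_reachable {K : ℕ} {A : Matrix (Fin K) (Fin K) ℝ}
    (hA : IsLeftStochastic A) {a b : Fin K}
    (h : Relation.ReflTransGen (fun a b => A a b ≠ 0) a b) : ∃ n, 0 < (A ^ n) a b := by
  induction h with
  | refl => exact ⟨0, by simp⟩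
  | tail _ hbc ih =>
    obtain ⟨n, hn⟩ := ih
    refine ⟨n + 1, hA.pow_add_pos hn ?_⟩
    rw [pow_one]
    exact lt_of_le_of_ne (hA.1 _ _) (Ne.symm hbc)

/-- Route every path through an agent with a self-loop: waiting there for a suitable number of steps
pads all paths to one common length. -/
theorem IsLeftStochastic.exists_pow_pos {K : ℕ} {A : Matrix (Fin K) (Fin K) ℝ}
    (hA : IsLeftStochastic A) (hconn : IsStronglyConnected A) :
    ∃ N, 0 < N ∧ ∀ a b, 0 < (A ^ N) a b := by
  obtain ⟨hreach, k, hk⟩ := hconn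
  choose p hp using fun a => hA.exists_pow_pos_of_reachable (hreach a k)
  choose q hq using fun b => hA.exists_pow_pos_of_reachable (hreach k b)
  have hloop : ∀ n, 0 < (A ^ n) k k := by
    intro n
    induction n with
    | zero => simp
    | succ n ih => exact hA.pow_add_pos ih (by simpa using hk)
  refine ⟨∑ a, p a + ∑ b, q b + 1, by omega, fun a b => ?_⟩
  have h₁ : p a ≤ ∑ a, p a := Finset.single_le_sum (fun _ _ => Nat.zero_le _) (Finset.mem_univ a)
  have h₂ : q b ≤ ∑ b, q b := Finset.single_le_sum (fun _ _ => Nat.zero_le _) (Finset.mem_univ b)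
  obtain ⟨r, hr⟩ : ∃ r, ∑ a, p a + ∑ b, q b + 1 = p a + r + q b :=
    ⟨∑ a, p a + ∑ b, q b + 1 - p a - q b, by omega⟩
  rw [hr]
  exact hA.pow_add_pos (hA.pow_add_pos (hp a) (hloop r)) (hq b)

/-- The all-ones row is a left eigenvector, so `A - 1` is singular and has a kernel vector `u`. The
triangle inequality gives `|u| ≤ A |u|` entrywise; both sides have the same total because columns
sum to one, so `|u|` is itself fixed. A positive power of `A` makes it positive. -/
theorem IsLeftStochastic.exists_isPerronVector {K : ℕ} {A : Matrix (Fin K) (Fin K) ℝ}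
    (hA : IsLeftStochastic A) (hconn : IsStronglyConnected A) : ∃ v, IsPerronVector A v := by
  obtain ⟨N, -, hN⟩ := hA.exists_pow_pos hconn
  obtain ⟨k₀, -⟩ := hconn.2
  have hdet : (A - 1).det = 0 := by
    rw [← Matrix.exists_vecMul_eq_zero_iff]
    refine ⟨1, fun h => one_ne_zero (congrFun h k₀), ?_⟩
    rw [Matrix.vecMul_sub, Matrix.one_vecMul_of_mem_colStochastic hA.mem_colStochastic,
      Matrix.vecMul_one, sub_self]
  obtain ⟨u, hu0, hu⟩ := Matrix.exists_mulVec_eq_zero_iff.2 hdet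
  have hAu : A.mulVec u = u := by
    rwa [Matrix.sub_mulVec, Matrix.one_mulVec, sub_eq_zero] at hu
  have hle : ∀ k, |u k| ≤ A.mulVec (fun k => |u k|) k := by
    intro k
    conv_lhs => rw [← hAu]
    refine (Finset.abs_sum_le_sum_abs (fun j => A k j * u j) Finset.univ).trans
      (Finset.sum_le_sum fun j _ => ?_)
    rw [abs_mul, abs_of_nonneg (hA.1 k j)]
  have hsum : ∑ k, |u k| = ∑ k, A.mulVec (fun k => |u k|) k := by
    simp only [Matrix.mulVec, dotProduct]
    rw [Finset.sum_comm]
    refine Finset.sum_congr rfl fun j _ => ?_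
    rw [← Finset.sum_mul, hA.2 j, one_mul]
  have habs : A.mulVec (fun k => |u k|) = fun k => |u k| := by
    funext k
    exact (((Finset.sum_eq_sum_iff_of_le fun k _ => hle k).1 hsum) k (Finset.mem_univ k)).symm
  have hpow : ∀ n, (A ^ n).mulVec (fun k => |u k|) = fun k => |u k| := by
    intro n
    induction n with
    | zero => simp
    | succ n ih => rw [pow_succ, ← Matrix.mulVec_mulVec, habs, ih]
  obtain ⟨j, hj⟩ := Function.ne_iff.1 hu0
  have hpos : ∀ k, 0 < |u k| := by
    intro k
    have := congrFun (hpow N) k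
    rw [← this]
    exact (mul_pos (hN k j) (abs_pos.2 hj)).trans_le (Finset.single_le_sum
      (f := fun j => (A ^ N) k j * |u j|)
      (fun i _ => mul_nonneg (hN k i).le (abs_nonneg _)) (Finset.mem_univ j))
  have hS : 0 < ∑ k, |u k| := Finset.sum_pos (fun k _ => hpos k) ⟨k₀, Finset.mem_univ _⟩
  refine ⟨(∑ k, |u k|)⁻¹ • fun k => |u k|, ?_, ?_, fun k => ?_⟩
  · rw [Matrix.mulVec_smul, habs]
  · simp only [Pi.smul_apply, smul_eq_mul]
    rw [← Finset.mul_sum, inv_mul_cancel₀ hS.ne']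
  · exact mul_pos (inv_pos.2 hS) (hpos k)

theorem abs_vecMul_le {K : ℕ} {M : Matrix (Fin K) (Fin K) ℝ} {c : ℝ} (h₀ : ∀ ℓ k, 0 ≤ M ℓ k)
    (hc : ∀ k, ∑ ℓ, M ℓ k = c) (x : Fin K → ℝ) (k : Fin K) :
    |Matrix.vecMul x M k| ≤ c * ‖x‖ := by
  refine (Finset.abs_sum_le_sum_abs (fun ℓ => x ℓ * M ℓ k) Finset.univ).trans ?_
  rw [← hc k, Finset.sum_mul]
  refine Finset.sum_le_sum fun ℓ _ => ?_
  rw [abs_mul, abs_of_nonneg (h₀ ℓ k), mul_comm]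
  exact mul_le_mul_of_nonneg_left (norm_le_pi_norm x ℓ) (h₀ ℓ k)

theorem IsLeftStochastic.norm_vecMul_le {K : ℕ} {A : Matrix (Fin K) (Fin K) ℝ}
    (hA : IsLeftStochastic A) (x : Fin K → ℝ) : ‖Matrix.vecMul x A‖ ≤ ‖x‖ := by
  rw [pi_norm_le_iff_of_nonneg (norm_nonneg x)]
  intro k
  simpa using abs_vecMul_le hA.1 hA.2 x k

theorem IsPerronVector.le_one {K : ℕ} {A : Matrix (Fin K) (Fin K) ℝ} {v : Fin K → ℝ}
    (hv : IsPerronVector A v) (k : Fin K) : v k ≤ 1 := by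
  rw [← hv.2.1]
  exact Finset.single_le_sum (fun j _ => (hv.2.2 j).le) (Finset.mem_univ k)

theorem IsPerronVector.vecMul_dotProduct {K : ℕ} {A : Matrix (Fin K) (Fin K) ℝ} {v : Fin K → ℝ}
    (hv : IsPerronVector A v) (x : Fin K → ℝ) : Matrix.vecMul x A ⬝ᵥ v = x ⬝ᵥ v := by
  rw [← Matrix.dotProduct_mulVec, hv.1]

/-- A left-stochastic matrix with positive entries contracts the sup norm, in its action from the
right, on the vectors orthogonal to the Perron vector. -/
theorem IsLeftStochastic.norm_vecMul_le_of_pos {K : ℕ} {M : Matrix (Fin K) (Fin K) ℝ}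
    (hM : IsLeftStochastic M) {δ : ℝ} (hδ₀ : 0 ≤ δ) (hδ₁ : δ ≤ 1) (hδ : ∀ ℓ k, δ ≤ M ℓ k)
    {v : Fin K → ℝ} (hv₁ : ∀ k, v k ≤ 1) (hv : ∑ k, v k = 1)
    {x : Fin K → ℝ} (hx : x ⬝ᵥ v = 0) : ‖Matrix.vecMul x M‖ ≤ (1 - δ) * ‖x‖ := by
  rw [pi_norm_le_iff_of_nonneg (mul_nonneg (by linarith) (norm_nonneg x))]
  intro k
  -- Since `x` is orthogonal to `v`, removing `δ v` from every column does not change the product.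
  -- The matrix left over is still nonnegative, as `v ≤ 1`, and its column sums drop to `1 - δ`.
  have heq : Matrix.vecMul x M k = Matrix.vecMul x (Matrix.of fun ℓ k => M ℓ k - δ * v ℓ) k := by
    have h : ∑ ℓ, x ℓ * (δ * v ℓ) = 0 := by
      have := congrArg (δ * ·) hx
      simp only [dotProduct, Finset.mul_sum, mul_zero] at this
      rw [← this]
      exact Finset.sum_congr rfl fun ℓ _ => by ring
    simp only [Matrix.vecMul, dotProduct, Matrix.of_apply, mul_sub, Finset.sum_sub_distrib, h,
      sub_zero]
  rw [heq]
  refine abs_vecMul_le (c := 1 - δ) (fun ℓ k => ?_) (fun k => ?_) x k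
  · simp only [Matrix.of_apply]
    have := mul_le_mul_of_nonneg_left (hv₁ ℓ) hδ₀
    linarith [hδ ℓ k]
  · simp only [Matrix.of_apply, Finset.sum_sub_distrib, ← Finset.mul_sum, hM.2 k, hv, mul_one]

/-- A norm adapted to a primitive left-stochastic matrix: its action from the right is a strict
contraction on the vectors orthogonal to the Perron vector. -/
theorem IsPerronVector.exists_adapted_norm {K : ℕ} {A : Matrix (Fin K) (Fin K) ℝ}
    (hA : IsLeftStochastic A) (hconn : IsStronglyConnected A) {v : Fin K → ℝ}
    (hv : IsPerronVector A v) :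
    ∃ (f : (Fin K → ℝ) → ℝ) (ρ C : ℝ), 0 < ρ ∧ ρ < 1 ∧ 0 ≤ C ∧ (∀ x, ‖x‖ ≤ f x) ∧
      (∀ x, f x ≤ C * ‖x‖) ∧ (∀ x y, f (x + y) ≤ f x + f y) ∧
      ∀ x, x ⬝ᵥ v = 0 → f (Matrix.vecMul x A) ≤ ρ * f x := by
  obtain ⟨N, hN, hpos⟩ := hA.exists_pow_pos hconn
  obtain ⟨k₀, -⟩ := hconn.2
  have : Nonempty (Fin K) := ⟨k₀⟩
  obtain ⟨p, hp⟩ := Finite.exists_min fun p : Fin K × Fin K => (A ^ N) p.1 p.2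
  have hp1 : (A ^ N) p.1 p.2 ≤ 1 := by
    rw [← (hA.pow N).2 p.2]
    exact Finset.single_le_sum (f := fun ℓ => (A ^ N) ℓ p.2) (fun j _ => (hA.pow N).1 j p.2)
      (Finset.mem_univ p.1)
  -- Half of the smallest entry, so that `δ < 1` even for a single agent, where that entry is one;
  -- this keeps `ρ` invertible.
  set δ : ℝ := (A ^ N) p.1 p.2 / 2 with hδ
  have hp0 := hpos p.1 p.2
  have hδ0 : 0 < δ := by positivity
  have hδ1 : δ < 1 := by linarith
  have hδle : ∀ ℓ k, δ ≤ (A ^ N) ℓ k := fun ℓ k => by have := hp (ℓ, k); simp only at this; linarith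
  set ρ : ℝ := (1 - δ) ^ (1 / (N : ℝ)) with hρ
  have hρ0 : 0 < ρ := Real.rpow_pos_of_pos (by linarith) _
  have hρ1 : ρ < 1 := Real.rpow_lt_one (by linarith) (by linarith) (by positivity)
  have hρN : ρ ^ N = 1 - δ := by
    rw [hρ, one_div, Real.rpow_inv_natCast_pow (by linarith) hN.ne']
  -- Applying `A` shifts this weighted sum by one index at the price of a factor `ρ`. The term
  -- pushed out at the end involves `A ^ N`, whose contraction by `1 - δ = ρ ^ N` turns it into `ρ`
  -- times the initial term.
  refine ⟨fun x => ∑ n ∈ Finset.range N, (ρ⁻¹) ^ n * ‖Matrix.vecMul x (A ^ n)‖, ρ,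
    ∑ n ∈ Finset.range N, (ρ⁻¹) ^ n, hρ0, hρ1, by positivity, fun x => ?_, fun x => ?_,
    fun x y => ?_, fun x hx => ?_⟩
  · have := Finset.single_le_sum (f := fun n => (ρ⁻¹) ^ n * ‖Matrix.vecMul x (A ^ n)‖)
      (s := Finset.range N) (fun n _ => by positivity) (Finset.mem_range.2 hN)
    simpa using this
  · rw [Finset.sum_mul]
    exact Finset.sum_le_sum fun n _ =>
      mul_le_mul_of_nonneg_left ((hA.pow n).norm_vecMul_le x) (by positivity)
  · rw [← Finset.sum_add_distrib]
    refine Finset.sum_le_sum fun n _ => ?_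
    rw [← mul_add, Matrix.add_vecMul]
    exact mul_le_mul_of_nonneg_left (norm_add_le _ _) (by positivity)
  · obtain ⟨m, rfl⟩ : ∃ m, N = m + 1 := ⟨N - 1, by omega⟩
    have hstep : ∀ n, Matrix.vecMul (Matrix.vecMul x A) (A ^ n) = Matrix.vecMul x (A ^ (n + 1)) :=
      fun n => by rw [Matrix.vecMul_vecMul, pow_succ']
    simp only [hstep]
    rw [Finset.sum_range_succ, Finset.sum_range_succ', mul_add, Finset.mul_sum]
    refine add_le_add (Finset.sum_le_sum fun n _ => ?_) ?_
    · rw [← mul_assoc, pow_succ ρ⁻¹, mul_comm _ ρ⁻¹, ← mul_assoc ρ, mul_inv_cancel₀ hρ0.ne',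
        one_mul]
    · have h := (hA.pow (m + 1)).norm_vecMul_le_of_pos hδ0.le hδ1.le hδle hv.le_one hv.2.1 hx
      rw [← hρN] at h
      calc (ρ⁻¹) ^ m * ‖Matrix.vecMul x (A ^ (m + 1))‖
          ≤ (ρ⁻¹) ^ m * (ρ ^ (m + 1) * ‖x‖) := mul_le_mul_of_nonneg_left h (by positivity)
        _ = ρ * ((ρ⁻¹) ^ 0 * ‖Matrix.vecMul x (A ^ 0)‖) := by
          rw [pow_succ, inv_pow]
          field_simp
          simp

/-! ### Uniqueness of the Perron vector and diffusion over the network -/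

theorem tendsto_zero_of_le_mul_add {ρ : ℝ} (hρ0 : 0 ≤ ρ) (hρ1 : ρ < 1) {a e : ℕ → ℝ}
    (ha : ∀ i, 0 ≤ a i) (he : Tendsto e atTop (𝓝 0)) (h : ∀ i, a (i + 1) ≤ ρ * a i + e i) :
    Tendsto a atTop (𝓝 0) := by
  rw [Metric.tendsto_atTop]
  intro ε hε
  -- The threshold for which `ε / 2` is the fixed point of `t ↦ ρ t + η`.
  have hη : 0 < ε / 2 * (1 - ρ) := by
    have : 0 < 1 - ρ := by linarith
    positivity
  obtain ⟨M, hM⟩ := eventually_atTop.1 (he.eventually_lt_const hη)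
  have hbound : ∀ n, a (M + n) ≤ ρ ^ n * a M + ε / 2 := by
    intro n
    induction n with
    | zero => simp; linarith
    | succ n ih =>
      have h₁ := h (M + n)
      have h₂ := hM (M + n) (by omega)
      have h₃ := mul_le_mul_of_nonneg_left ih hρ0
      rw [← add_assoc, pow_succ]
      nlinarith
  have hlim : Tendsto (fun n => ρ ^ n * a M) atTop (𝓝 0) := by
    simpa using (tendsto_pow_atTop_nhds_zero_of_lt_one hρ0 hρ1).mul_const (a M)
  obtain ⟨n₀, hn₀⟩ := eventually_atTop.1 (hlim.eventually_lt_const (half_pos hε))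
  refine ⟨M + n₀, fun i hi => ?_⟩
  have h₁ := hbound (i - M)
  have h₂ := hn₀ (i - M) (by omega)
  rw [show M + (i - M) = i by omega] at h₁
  rw [Real.dist_eq, sub_zero, abs_of_nonneg (ha i)]
  linarith

/-- If `x` is orthogonal to `v`, then `x A ^ n` tends to zero while its pairing with another Perron
vector `v'` stays constant. So `v'` annihilates the hyperplane orthogonal to `v`, and the
normalization fixes the scalar. -/
theorem IsLeftStochastic.existsUnique_isPerronVector {K : ℕ} {A : Matrix (Fin K) (Fin K) ℝ}
    (hA : IsLeftStochastic A) (hconn : IsStronglyConnected A) : ∃! v, IsPerronVector A v := by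
  obtain ⟨v, hv⟩ := hA.exists_isPerronVector hconn
  refine ⟨v, hv, fun v' hv' => ?_⟩
  obtain ⟨f, ρ, C, hρ0, hρ1, hC, hf₁, hf₂, -, hf⟩ := hv.exists_adapted_norm hA hconn
  have key : ∀ x, x ⬝ᵥ v = 0 → x ⬝ᵥ v' = 0 := by
    intro x hx
    have hpow : ∀ n, Matrix.vecMul x (A ^ n) ⬝ᵥ v = 0 ∧ Matrix.vecMul x (A ^ n) ⬝ᵥ v' = x ⬝ᵥ v' ∧
        f (Matrix.vecMul x (A ^ n)) ≤ ρ ^ n * f x := by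
      intro n
      induction n with
      | zero => simp [hx]
      | succ n ih =>
        rw [pow_succ, ← Matrix.vecMul_vecMul, hv.vecMul_dotProduct, hv'.vecMul_dotProduct]
        refine ⟨ih.1, ih.2.1, (hf _ ih.1).trans ?_⟩
        rw [pow_succ, mul_comm _ ρ, mul_assoc]
        exact mul_le_mul_of_nonneg_left ih.2.2 hρ0.le
    have hbd : ∀ n, |x ⬝ᵥ v'| ≤ ρ ^ n * f x := by
      intro n
      obtain ⟨-, h₂, h₃⟩ := hpow n
      rw [← h₂]
      refine (Finset.abs_sum_le_sum_abs _ _).trans (le_trans ?_ ((hf₁ _).trans h₃))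
      calc ∑ k, |Matrix.vecMul x (A ^ n) k * v' k|
          ≤ ∑ k, ‖Matrix.vecMul x (A ^ n)‖ * v' k := by
            refine Finset.sum_le_sum fun k _ => ?_
            rw [abs_mul, abs_of_pos (hv'.2.2 k)]
            exact mul_le_mul_of_nonneg_right (norm_le_pi_norm (Matrix.vecMul x (A ^ n)) k)
              (hv'.2.2 k).le
        _ = ‖Matrix.vecMul x (A ^ n)‖ := by rw [← Finset.mul_sum, hv'.2.1, mul_one]
    have hlim : Tendsto (fun n => ρ ^ n * f x) atTop (𝓝 0) := by
      simpa using (tendsto_pow_atTop_nhds_zero_of_lt_one hρ0.le hρ1).mul_const (f x)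
    exact abs_nonpos_iff.1 (ge_of_tendsto' hlim hbd)
  funext k
  -- The test vector whose pairing with `v'` is `v' k - v k`.
  have h₁ : (Pi.single k 1 - fun _ => v k) ⬝ᵥ v = 0 := by
    rw [sub_dotProduct, single_dotProduct, one_mul]
    simp [dotProduct, ← Finset.mul_sum, hv.2.1]
  have h₂ := key _ h₁
  rw [sub_dotProduct, single_dotProduct, one_mul] at h₂
  simp only [dotProduct, ← Finset.mul_sum, hv'.2.1, mul_one] at h₂
  linarith

/-- Diffusion over a connected network: the iterates follow the Perron average of the cumulated
inputs, up to an error which is small compared with `w` if the inputs are. -/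
theorem IsPerronVector.tendsto_diffusion {K : ℕ} {A : Matrix (Fin K) (Fin K) ℝ}
    (hA : IsLeftStochastic A) (hconn : IsStronglyConnected A) {v : Fin K → ℝ}
    (hv : IsPerronVector A v) {y S : ℕ → Fin K → ℝ} (h0 : y 0 = S 0)
    (hrec : ∀ i, y (i + 1) = Matrix.vecMul (y i + (S (i + 1) - S i)) A) {w : ℕ → ℝ}
    (hw : Monotone w) (hw0 : ∀ i, 0 < w i)
    (hS : ∀ k, Tendsto (fun i => (S (i + 1) k - S i k) / w i) atTop (𝓝 0)) (k : Fin K) :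
    Tendsto (fun i => (y i k - S i ⬝ᵥ v) / w i) atTop (𝓝 0) := by
  obtain ⟨f, ρ, C, hρ0, hρ1, hC, hf₁, hf₂, hf₃, hf⟩ := hv.exists_adapted_norm hA hconn
  have hf0 : ∀ x, 0 ≤ f x := fun x => (norm_nonneg x).trans (hf₁ x)
  have hyS : ∀ i, y i ⬝ᵥ v = S i ⬝ᵥ v := by
    intro i
    induction i with
    | zero => rw [h0]
    | succ i ih => rw [hrec, hv.vecMul_dotProduct, add_dotProduct, sub_dotProduct, ih]; ring
  have hconst : ∀ c : ℝ, Matrix.vecMul (fun _ : Fin K => c) A = fun _ => c := by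
    intro c
    funext k
    simp [Matrix.vecMul, dotProduct, ← Finset.mul_sum, hA.2 k]
  have hcv : ∀ c : ℝ, (fun _ : Fin K => c) ⬝ᵥ v = c := by
    intro c
    simp [dotProduct, ← Finset.mul_sum, hv.2.1]
  -- Removing the conserved average, a constant vector fixed by the right action of `A`, leaves a
  -- recursion inside the hyperplane where `A` contracts.
  set z : ℕ → Fin K → ℝ := fun i => y i - fun _ => S i ⬝ᵥ v with hz
  set d : ℕ → Fin K → ℝ := fun i => (S (i + 1) - S i) - fun _ => (S (i + 1) - S i) ⬝ᵥ v with hd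
  have hzv : ∀ i, z i ⬝ᵥ v = 0 := fun i => by simp only [hz]; rw [sub_dotProduct, hcv, hyS, sub_self]
  have hdv : ∀ i, d i ⬝ᵥ v = 0 := fun i => by simp only [hd]; rw [sub_dotProduct, hcv, sub_self]
  have hzrec : ∀ i, z (i + 1) = Matrix.vecMul (z i + d i) A := by
    intro i
    have : z i + d i = (y i + (S (i + 1) - S i)) - fun _ => S (i + 1) ⬝ᵥ v := by
      funext k
      simp only [hz, hd, Pi.add_apply, Pi.sub_apply, sub_dotProduct]
      ring
    rw [this, Matrix.sub_vecMul, hconst, ← hrec]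
  have hdlim : Tendsto (fun i => f (d i) / w i) atTop (𝓝 0) := by
    have hk : ∀ k, Tendsto (fun i => d i k / w i) atTop (𝓝 0) := by
      intro k
      have h := (hS k).sub (tendsto_finsetSum Finset.univ fun j _ => (hS j).mul_const (v j))
      simp only [zero_mul, Finset.sum_const_zero, sub_zero] at h
      refine h.congr fun i => ?_
      simp only [hd, Pi.sub_apply, dotProduct, sub_div, Finset.sum_div]
      congr 1
      exact Finset.sum_congr rfl fun j _ => by ring
    have hvec : Tendsto (fun i => (w i)⁻¹ • d i) atTop (𝓝 0) := by
      rw [tendsto_pi_nhds]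
      intro k
      refine (hk k).congr fun i => ?_
      simp [div_eq_inv_mul]
    have hn := hvec.norm.const_mul C
    rw [norm_zero, mul_zero] at hn
    refine squeeze_zero (fun i => div_nonneg (hf0 _) (hw0 i).le) (fun i => ?_) hn
    rw [norm_smul, norm_inv, Real.norm_of_nonneg (hw0 i).le, div_le_iff₀ (hw0 i)]
    have := (hw0 i).ne'
    calc f (d i) ≤ C * ‖d i‖ := hf₂ _
      _ = _ := by field_simp
  have hzlim : Tendsto (fun i => f (z i) / w i) atTop (𝓝 0) := by
    refine tendsto_zero_of_le_mul_add hρ0.le hρ1 (fun i => div_nonneg (hf0 _) (hw0 i).le)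
      (e := fun i => ρ * (f (d i) / w i)) (by simpa using hdlim.const_mul ρ) fun i => ?_
    have h₁ : f (z (i + 1)) ≤ ρ * (f (z i) + f (d i)) := by
      rw [hzrec]
      refine (hf _ (by rw [add_dotProduct, hzv, hdv, add_zero])).trans ?_
      exact mul_le_mul_of_nonneg_left (hf₃ _ _) hρ0.le
    -- Monotonicity of `w` brings both sides of the recursion to the same denominator.
    calc f (z (i + 1)) / w (i + 1) ≤ f (z (i + 1)) / w i :=
          div_le_div_of_nonneg_left (hf0 _) (hw0 i) (hw (Nat.le_succ i))
      _ ≤ ρ * (f (z i) + f (d i)) / w i := div_le_div_of_nonneg_right h₁ (hw0 i).le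
      _ = _ := by ring
  refine squeeze_zero_norm (fun i => ?_) hzlim
  rw [norm_div, Real.norm_of_nonneg (hw0 i).le]
  exact div_le_div_of_nonneg_right ((norm_le_pi_norm (z i) k).trans (hf₁ _)) (hw0 i).le

/-! ### Beliefs in terms of the odds of the transmitted hypothesis -/

/-- The belief with odds `r` in favor of `T` that shares the mass of the other hypotheses in
proportion to `p`. -/
noncomputable def oddsBelief {H : ℕ} (T : Fin H) (p : Fin H → ℝ) (r : ℝ) (θ : Fin H) : ℝ :=
  (if θ = T then r else p θ / ∑ τ ∈ Finset.univ.erase T, p τ) / (1 + r)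

theorem oddsBelief_self {H : ℕ} (T : Fin H) (p : Fin H → ℝ) (r : ℝ) :
    oddsBelief T p r T = r / (1 + r) := by
  simp [oddsBelief]

theorem oddsBelief_of_ne {H : ℕ} {T θ : Fin H} (h : θ ≠ T) (p : Fin H → ℝ) (r : ℝ) :
    oddsBelief T p r θ = p θ / (∑ τ ∈ Finset.univ.erase T, p τ) / (1 + r) := by
  simp [oddsBelief, h]

/-- Bayes' rule multiplies the odds by the likelihood of `T` over that of the mixture of the other
hypotheses with weights proportional to `p`. -/
theorem bayesUpdate_oddsBelief {H : ℕ} {T : Fin H} (hne : (Finset.univ.erase T).Nonempty)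
    {l p : Fin H → ℝ} (hl : ∀ θ, 0 < l θ) (hp : ∀ θ, 0 < p θ) {r : ℝ} (hr : 0 < r) :
    bayesUpdate l (oddsBelief T p r) = oddsBelief T (fun θ => l θ * p θ)
      (r * (l T * (∑ τ ∈ Finset.univ.erase T, p τ) / ∑ τ ∈ Finset.univ.erase T, l τ * p τ)) := by
  have hW : 0 < ∑ τ ∈ Finset.univ.erase T, p τ := Finset.sum_pos (fun τ _ => hp τ) hne
  have hW' : 0 < ∑ τ ∈ Finset.univ.erase T, l τ * p τ :=
    Finset.sum_pos (fun τ _ => mul_pos (hl τ) (hp τ)) hne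
  have hlT := hl T
  have hsum : ∑ τ, l τ * oddsBelief T p r τ = (l T * r + (∑ τ ∈ Finset.univ.erase T, l τ * p τ) /
      ∑ τ ∈ Finset.univ.erase T, p τ) / (1 + r) := by
    rw [← Finset.add_sum_erase _ _ (Finset.mem_univ T), oddsBelief_self, add_div, mul_div_assoc,
      Finset.sum_div, Finset.sum_div]
    congr 1
    refine Finset.sum_congr rfl fun τ hτ => ?_
    rw [oddsBelief_of_ne (Finset.ne_of_mem_erase hτ)]
    ring
  funext θ
  rw [bayesUpdate, hsum]
  by_cases h : θ = T
  · subst h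
    rw [oddsBelief_self, oddsBelief_self]
    field_simp
    ring
  · rw [oddsBelief_of_ne h, oddsBelief_of_ne h]
    field_simp
    ring

/-- All filled vectors carry the same shares, those of agent `k`, and a geometric mean with weights
of sum one leaves a common value unchanged. The factors `(1 + r ℓ) ^ w ℓ` are common to all
hypotheses and cancel in the normalization, so just the odds are averaged. -/
theorem geometricCombine_memoryAwareFill {K H : ℕ} {T : Fin H}
    (hne : (Finset.univ.erase T).Nonempty) {w : Fin K → ℝ} (hw : ∑ ℓ, w ℓ = 1)
    {p : Fin K → Fin H → ℝ} (hp : ∀ ℓ θ, 0 < p ℓ θ) {r : Fin K → ℝ} (hr : ∀ ℓ, 0 < r ℓ)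
    (k : Fin K) :
    geometricCombine w (fun ℓ => memoryAwareFill T (oddsBelief T (p k) (r k))
      (oddsBelief T (p ℓ) (r ℓ) T)) = oddsBelief T (p k) (∏ ℓ, r ℓ ^ w ℓ) := by
  have hW : 0 < ∑ τ ∈ Finset.univ.erase T, p k τ := Finset.sum_pos (fun τ _ => hp k τ) hne
  have hr1 : ∀ ℓ, 0 < 1 + r ℓ := fun ℓ => by linarith [hr ℓ]
  have hD : 0 < ∏ ℓ, (1 + r ℓ) ^ w ℓ := Finset.prod_pos fun ℓ _ => Real.rpow_pos_of_pos (hr1 ℓ) _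
  have hR : 0 < ∏ ℓ, r ℓ ^ w ℓ := Finset.prod_pos fun ℓ _ => Real.rpow_pos_of_pos (hr ℓ) _
  have hT : ∏ ℓ, memoryAwareFill T (oddsBelief T (p k) (r k)) (oddsBelief T (p ℓ) (r ℓ) T) T ^ w ℓ
      = (∏ ℓ, r ℓ ^ w ℓ) / ∏ ℓ, (1 + r ℓ) ^ w ℓ := by
    rw [← Finset.prod_div_distrib]
    refine Finset.prod_congr rfl fun ℓ _ => ?_
    rw [memoryAwareFill, if_pos rfl, oddsBelief_self, Real.div_rpow (hr ℓ).le (hr1 ℓ).le]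
  have hθ : ∀ θ, θ ≠ T →
      ∏ ℓ, memoryAwareFill T (oddsBelief T (p k) (r k)) (oddsBelief T (p ℓ) (r ℓ) T) θ ^ w ℓ
      = p k θ / (∑ τ ∈ Finset.univ.erase T, p k τ) / ∏ ℓ, (1 + r ℓ) ^ w ℓ := by
    intro θ h
    have hq : 0 < p k θ / (∑ τ ∈ Finset.univ.erase T, p k τ) := div_pos (hp k θ) hW
    have hprod : p k θ / (∑ τ ∈ Finset.univ.erase T, p k τ) =
        ∏ ℓ, (p k θ / (∑ τ ∈ Finset.univ.erase T, p k τ)) ^ w ℓ := by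
      rw [← Real.rpow_sum_of_pos hq, hw, Real.rpow_one]
    rw [hprod, ← Finset.prod_div_distrib]
    refine Finset.prod_congr rfl fun ℓ _ => ?_
    rw [memoryAwareFill, if_neg h, oddsBelief_self, oddsBelief_self, oddsBelief_of_ne h,
      ← Real.div_rpow hq.le (hr1 ℓ).le]
    congr 1
    have h₁ := (hr1 k).ne'
    have h₂ := (hr1 ℓ).ne'
    rw [show 1 - r k / (1 + r k) = 1 / (1 + r k) by field_simp; ring,
      show 1 - r ℓ / (1 + r ℓ) = 1 / (1 + r ℓ) by field_simp; ring]
    field_simp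
  have hsum : ∑ τ, ∏ ℓ,
      memoryAwareFill T (oddsBelief T (p k) (r k)) (oddsBelief T (p ℓ) (r ℓ) T) τ ^ w ℓ
      = (1 + ∏ ℓ, r ℓ ^ w ℓ) / ∏ ℓ, (1 + r ℓ) ^ w ℓ := by
    rw [← Finset.add_sum_erase _ _ (Finset.mem_univ T), hT,
      Finset.sum_congr rfl fun τ hτ => hθ τ (Finset.ne_of_mem_erase hτ), ← Finset.sum_div,
      ← Finset.sum_div, div_self hW.ne']
    ring
  funext θ
  rw [geometricCombine, hsum]
  by_cases h : θ = T
  · subst h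
    rw [hT, oddsBelief_self]
    field_simp
  · rw [hθ θ h, oddsBelief_of_ne h]
    field_simp

/-- The likelihood, for each agent and hypothesis, of the first `i` observations. -/
noncomputable def jointLikelihood {K H : ℕ} (l : ℕ → Fin K → Fin H → ℝ) (i : ℕ) (k : Fin K)
    (θ : Fin H) : ℝ :=
  ∏ j ∈ Finset.range i, l j k θ

/-- The logarithmic likelihood ratio, after `i` observations, of `T` against the sum over all the
other hypotheses. -/
noncomputable def cumulatedInput {K H : ℕ} (l : ℕ → Fin K → Fin H → ℝ) (T : Fin H) (i : ℕ)
    (k : Fin K) : ℝ :=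
  Real.log (jointLikelihood l i k T / ∑ τ ∈ Finset.univ.erase T, jointLikelihood l i k τ)

/-- The logarithmic odds of the belief in the transmitted hypothesis. -/
noncomputable def logOdds {K H : ℕ} (A : Matrix (Fin K) (Fin K) ℝ) (l : ℕ → Fin K → Fin H → ℝ)
    (T : Fin H) : ℕ → Fin K → ℝ
  | 0 => cumulatedInput l T 0
  | i + 1 => Matrix.vecMul
      (logOdds A l T i + (cumulatedInput l T (i + 1) - cumulatedInput l T i)) A

theorem jointLikelihood_pos {K H : ℕ} {l : ℕ → Fin K → Fin H → ℝ} (hl : ∀ i k θ, 0 < l i k θ)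
    (i : ℕ) (k : Fin K) (θ : Fin H) : 0 < jointLikelihood l i k θ :=
  Finset.prod_pos fun j _ => hl j k θ

theorem jointLikelihood_succ {K H : ℕ} (l : ℕ → Fin K → Fin H → ℝ)
    (i : ℕ) (k : Fin K) (θ : Fin H) :
    jointLikelihood l (i + 1) k θ = l i k θ * jointLikelihood l i k θ := by
  rw [jointLikelihood, Finset.prod_range_succ, mul_comm]; rfl

/-- The exact solution of the algorithm. The factor by which Bayes' rule multiplies the odds is the
exponential of an increment of `cumulatedInput`, and geometric averaging of odds is linear averaging
of their logarithms. -/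
theorem belief_eq_oddsBelief {K H : ℕ} {A : Matrix (Fin K) (Fin K) ℝ} (hA : IsLeftStochastic A)
    {T : Fin H} (hne : (Finset.univ.erase T).Nonempty) {l : ℕ → Fin K → Fin H → ℝ}
    (hl : ∀ i k θ, 0 < l i k θ) {b : ℕ → Fin K → Fin H → ℝ} (hb0 : b 0 = fun _ _ => 1 / (H : ℝ))
    (hb : ∀ i, b (i + 1) = beliefStep A T (l i) (b i)) (i : ℕ) (k : Fin K) :
    b i k = oddsBelief T (jointLikelihood l i k) (Real.exp (logOdds A l T i k)) := by
  have hP := jointLikelihood_pos hl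
  have hW : ∀ i k, 0 < ∑ τ ∈ Finset.univ.erase T, jointLikelihood l i k τ :=
    fun i k => Finset.sum_pos (fun τ _ => hP i k τ) hne
  have hS : ∀ i k, Real.exp (cumulatedInput l T i k) =
      jointLikelihood l i k T / ∑ τ ∈ Finset.univ.erase T, jointLikelihood l i k τ :=
    fun i k => Real.exp_log (div_pos (hP i k T) (hW i k))
  induction i generalizing k with
  | zero =>
    rw [hb0]
    -- Empty products are one, so the initial odds are `1 / (H - 1)`, which is the uniform belief.
    have hH : ((Finset.univ.erase T).card : ℝ) + 1 = H := by
      have := Finset.card_erase_add_one (Finset.mem_univ T)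
      rw [Finset.card_univ, Fintype.card_fin] at this
      exact_mod_cast this
    have hc : (0 : ℝ) < (Finset.univ.erase T).card := by exact_mod_cast hne.card_pos
    funext θ
    rw [logOdds, hS, ← hH]
    by_cases h : θ = T
    · subst h
      rw [oddsBelief_self]
      simp only [jointLikelihood, Finset.range_zero, Finset.prod_empty, Finset.sum_const,
        nsmul_eq_mul, mul_one]
      field_simp
    · rw [oddsBelief_of_ne h]
      simp only [jointLikelihood, Finset.range_zero, Finset.prod_empty, Finset.sum_const,
        nsmul_eq_mul, mul_one]
      field_simp
  | succ i ih =>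
    have hbayes : ∀ k, bayesUpdate (l i k) (b i k) = oddsBelief T (jointLikelihood l (i + 1) k)
        (Real.exp ((logOdds A l T i + (cumulatedInput l T (i + 1) - cumulatedInput l T i)) k)) := by
      intro k
      rw [ih, bayesUpdate_oddsBelief hne (hl i k) (hP i k) (Real.exp_pos _)]
      simp only [← jointLikelihood_succ, Pi.add_apply, Pi.sub_apply]
      rw [Real.exp_add, Real.exp_sub, hS, hS, jointLikelihood_succ l i k T]
      have h₁ := (hW i k).ne'
      have h₂ := (hW (i + 1) k).ne'
      have h₃ := (hP i k T).ne'
      congr 2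
      field_simp
    rw [hb]
    unfold beliefStep
    simp only [hbayes]
    rw [geometricCombine_memoryAwareFill hne (hA.2 k) (fun k θ => hP (i + 1) k θ)
      (fun k => Real.exp_pos _) k, logOdds]
    congr 1
    simp only [Matrix.vecMul, dotProduct, Real.exp_sum]
    exact Finset.prod_congr rfl fun ℓ _ => (Real.exp_mul _ _).symm

/-- The degenerate case of a single hypothesis, where the odds would be infinite. -/
theorem belief_eq_one {K H : ℕ} {A : Matrix (Fin K) (Fin K) ℝ} {T : Fin H} (hT : ∀ θ, θ = T)
    {l : ℕ → Fin K → Fin H → ℝ}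
    (hl : ∀ i k θ, 0 < l i k θ) {b : ℕ → Fin K → Fin H → ℝ} (hb0 : b 0 = fun _ _ => 1 / (H : ℝ))
    (hb : ∀ i, b (i + 1) = beliefStep A T (l i) (b i)) (i : ℕ) (k : Fin K) : b i k T = 1 := by
  have huniv : (Finset.univ : Finset (Fin H)) = {T} := by
    ext θ
    simp [hT θ]
  induction i generalizing k with
  | zero =>
    have hH : H = 1 := by simpa using congrArg Finset.card huniv
    simp [hb0, hH]
  | succ i ih =>
    rw [hb]
    simp only [beliefStep, geometricCombine, bayesUpdate, memoryAwareFill, huniv,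
      Finset.sum_singleton, ih, mul_one, if_true]
    simp [fun ℓ => div_self (hl i ℓ T).ne']

/-! ### Asymptotics -/

/-- A sum of exponentials grows at the largest of the rates of its terms. -/
theorem tendsto_log_sum_exp_div {ι : Type*} {s : Finset ι} (hs : s.Nonempty) {a : ℕ → ι → ℝ}
    {c : ι → ℝ} (h : ∀ τ ∈ s, Tendsto (fun i : ℕ => a i τ / i) atTop (𝓝 (c τ))) :
    Tendsto (fun i : ℕ => Real.log (∑ τ ∈ s, Real.exp (a i τ)) / i) atTop (𝓝 (s.sup' hs c)) := by
  have hsup := Tendsto.finset_sup'_nhds_apply (f := fun τ (i : ℕ) => a i τ / i) hs h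
  have hcard : Tendsto (fun i : ℕ => Real.log s.card / i) atTop (𝓝 0) :=
    tendsto_const_nhds.div_atTop tendsto_natCast_atTop_atTop
  have hup := hsup.add hcard
  rw [add_zero] at hup
  refine tendsto_of_tendsto_of_tendsto_of_le_of_le' hsup hup ?_ ?_
  -- Lower bound: the sum dominates each of its terms.
  · filter_upwards [eventually_gt_atTop 0] with i hi
    have hi' : (0 : ℝ) < i := by exact_mod_cast hi
    refine Finset.sup'_le hs _ fun τ hτ => div_le_div_of_nonneg_right ?_ hi'.le
    rw [Real.le_log_iff_exp_le (Finset.sum_pos (fun _ _ => Real.exp_pos _) hs)]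
    exact Finset.single_le_sum (f := fun τ => Real.exp (a i τ))
      (fun _ _ => (Real.exp_pos _).le) hτ
  -- Upper bound: the sum is at most the number of terms times the largest one.
  · filter_upwards [eventually_gt_atTop 0] with i hi
    have hi' : (0 : ℝ) < i := by exact_mod_cast hi
    have hc : (0 : ℝ) < s.card := by exact_mod_cast hs.card_pos
    rw [← sub_le_iff_le_add, ← sub_div, div_le_iff₀ hi', sub_le_iff_le_add]
    refine (Real.log_le_iff_le_exp (Finset.sum_pos (fun _ _ => Real.exp_pos _) hs)).2 ?_
    rw [Real.exp_add, Real.exp_log hc, mul_comm, ← nsmul_eq_mul]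
    refine Finset.sum_le_card_nsmul s _ _ fun τ hτ => Real.exp_le_exp.2 ?_
    rw [← div_le_iff₀ hi']
    exact Finset.le_sup' (fun τ => a i τ / i) hτ

/-- The increments of a sequence of asymptotically linear growth are sublinear. -/
theorem tendsto_increment_div {a : ℕ → ℝ} {c : ℝ}
    (h : Tendsto (fun i : ℕ => a i / i) atTop (𝓝 c)) :
    Tendsto (fun i : ℕ => (a (i + 1) - a i) / ((i : ℝ) + 1)) atTop (𝓝 0) := by
  have h₁ : Tendsto (fun i : ℕ => a (i + 1) / ((i + 1 : ℕ) : ℝ)) atTop (𝓝 c) :=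
    h.comp (tendsto_add_atTop_nat 1)
  have h₂ : Tendsto (fun i : ℕ => a i / i * ((i : ℝ) / ((i : ℝ) + 1))) atTop (𝓝 (c * 1)) :=
    h.mul (tendsto_natCast_div_add_atTop (1 : ℝ))
  have h₃ := h₁.sub h₂
  rw [mul_one, sub_self] at h₃
  refine h₃.congr' ?_
  filter_upwards [eventually_gt_atTop 0] with i hi
  have hi' : (0 : ℝ) < i := by exact_mod_cast hi
  push_cast
  field_simp

theorem tendsto_atTop_of_tendsto_div {a : ℕ → ℝ} {c : ℝ} (hc : 0 < c)
    (h : Tendsto (fun i : ℕ => a i / ((i : ℝ) + 1)) atTop (𝓝 c)) : Tendsto a atTop atTop := by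
  have h₁ : Tendsto (fun i : ℕ => (i : ℝ) + 1) atTop atTop :=
    tendsto_atTop_add_const_right _ _ tendsto_natCast_atTop_atTop
  refine (h.pos_mul_atTop hc h₁).congr fun i => ?_
  have : (0 : ℝ) < (i : ℝ) + 1 := by positivity
  field_simp

/-- The logarithmic likelihood ratio of `θ` against `θ₀` after `i` observations. -/
noncomputable def logRatio {K H : ℕ} (l : ℕ → Fin K → Fin H → ℝ) (θ₀ : Fin H) (i : ℕ)
    (k : Fin K) (θ : Fin H) : ℝ :=
  ∑ j ∈ Finset.range i, Real.log (l j k θ / l j k θ₀)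

/-- A typical sequence of likelihoods: all are positive, those of the hypotheses outside `D k`
agree with those of `θ₀`, and the likelihood ratios of the others decay exponentially, at the
rates `d k`. -/
structure IsTypical {K H : ℕ} (l : ℕ → Fin K → Fin H → ℝ) (θ₀ : Fin H)
    (D : Fin K → Finset (Fin H)) (d : Fin K → Fin H → ℝ) : Prop where
  pos : ∀ i k θ, 0 < l i k θ
  not_mem : ∀ k, θ₀ ∉ D k
  eq_of_not_mem : ∀ i k θ, θ ∉ D k → l i k θ = l i k θ₀
  rate_pos : ∀ k, ∀ θ ∈ D k, 0 < d k θ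
  rate_zero : ∀ k, ∀ θ ∉ D k, d k θ = 0
  tendsto : ∀ k θ, Tendsto (fun i : ℕ => logRatio l θ₀ i k θ / i) atTop (𝓝 (-d k θ))

/-! ### Shares and log-odds along typical sequences -/

namespace IsTypical

variable {K H : ℕ} {l : ℕ → Fin K → Fin H → ℝ} {θ₀ : Fin H} {D : Fin K → Finset (Fin H)}
  {d : Fin K → Fin H → ℝ}

theorem rate_nonneg (h : IsTypical l θ₀ D d) (k : Fin K) (θ : Fin H) : 0 ≤ d k θ := by
  by_cases hθ : θ ∈ D k
  · exact (h.rate_pos k θ hθ).le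
  · exact (h.rate_zero k θ hθ).ge

theorem jointLikelihood_eq (h : IsTypical l θ₀ D d) (i : ℕ) (k : Fin K) (θ : Fin H) :
    jointLikelihood l i k θ = jointLikelihood l i k θ₀ * Real.exp (logRatio l θ₀ i k θ) := by
  rw [logRatio, Real.exp_sum, jointLikelihood, jointLikelihood, ← Finset.prod_mul_distrib]
  refine Finset.prod_congr rfl fun j _ => ?_
  rw [Real.exp_log (div_pos (h.pos j k θ) (h.pos j k θ₀)), mul_div_cancel₀ _ (h.pos j k θ₀).ne']

theorem sum_jointLikelihood_eq (h : IsTypical l θ₀ D d) (i : ℕ) (k : Fin K) (s : Finset (Fin H)) :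
    ∑ τ ∈ s, jointLikelihood l i k τ =
      jointLikelihood l i k θ₀ * ∑ τ ∈ s, Real.exp (logRatio l θ₀ i k τ) := by
  rw [Finset.mul_sum]
  exact Finset.sum_congr rfl fun τ _ => h.jointLikelihood_eq i k τ

theorem share_eq (h : IsTypical l θ₀ D d) (i : ℕ) (k : Fin K) (s : Finset (Fin H)) (θ : Fin H) :
    jointLikelihood l i k θ / ∑ τ ∈ s, jointLikelihood l i k τ =
      Real.exp (logRatio l θ₀ i k θ) / ∑ τ ∈ s, Real.exp (logRatio l θ₀ i k τ) := by
  rw [h.sum_jointLikelihood_eq, h.jointLikelihood_eq i k θ,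
    mul_div_mul_left _ _ (jointLikelihood_pos h.pos i k θ₀).ne']

theorem cumulatedInput_eq (h : IsTypical l θ₀ D d) {T : Fin H}
    (hne : (Finset.univ.erase T).Nonempty) (i : ℕ) (k : Fin K) :
    cumulatedInput l T i k = logRatio l θ₀ i k T -
      Real.log (∑ τ ∈ Finset.univ.erase T, Real.exp (logRatio l θ₀ i k τ)) := by
  rw [cumulatedInput, h.share_eq, Real.log_div (Real.exp_pos _).ne'
    (Finset.sum_pos (fun _ _ => Real.exp_pos _) hne).ne', Real.log_exp]

/-- Outside `D k` a vanishing rate alone would not determine the limit; there the log-ratio is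
identically zero because the likelihoods coincide. -/
theorem tendsto_exp_logRatio (h : IsTypical l θ₀ D d) (k : Fin K) (θ : Fin H) :
    Tendsto (fun i => Real.exp (logRatio l θ₀ i k θ)) atTop (𝓝 (if θ ∈ D k then 0 else 1)) := by
  split_ifs with hθ
  · refine Real.tendsto_exp_atBot.comp ?_
    have := (h.tendsto k θ).neg_mul_atTop (neg_neg_of_pos (h.rate_pos k θ hθ))
      tendsto_natCast_atTop_atTop
    refine this.congr' ?_
    filter_upwards [eventually_gt_atTop 0] with i hi
    have hi' : (0 : ℝ) < i := by exact_mod_cast hi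
    field_simp
  · refine tendsto_const_nhds.congr fun i => ?_
    rw [logRatio, Finset.sum_eq_zero, Real.exp_zero]
    intro j _
    rw [h.eq_of_not_mem j k θ hθ, div_self (h.pos j k θ₀).ne', Real.log_one]

theorem tendsto_sum_exp_logRatio (h : IsTypical l θ₀ D d) (k : Fin K) (s : Finset (Fin H)) :
    Tendsto (fun i => ∑ τ ∈ s, Real.exp (logRatio l θ₀ i k τ)) atTop
      (𝓝 ((s \ D k).card : ℝ)) := by
  have := tendsto_finsetSum s fun τ _ => h.tendsto_exp_logRatio k τ
  convert this using 2
  rw [Finset.card_eq_sum_ones, ← Finset.filter_notMem_eq_sdiff, Finset.sum_filter]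
  push_cast
  exact Finset.sum_congr rfl fun τ _ => by split_ifs <;> simp_all

theorem tendsto_share (h : IsTypical l θ₀ D d) (k : Fin K) {s : Finset (Fin H)}
    (hs : (s \ D k).Nonempty) (θ : Fin H) :
    Tendsto (fun i => jointLikelihood l i k θ / ∑ τ ∈ s, jointLikelihood l i k τ) atTop
      (𝓝 ((if θ ∈ D k then 0 else 1) / ((s \ D k).card : ℝ))) := by
  have hc : ((s \ D k).card : ℝ) ≠ 0 := by exact_mod_cast hs.card_pos.ne'
  refine ((h.tendsto_exp_logRatio k θ).div (h.tendsto_sum_exp_logRatio k s) hc).congr fun i => ?_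
  exact (h.share_eq i k s θ).symm

/-- The logarithmic odds of the transmitted hypothesis grow linearly, at the Perron average of
the rates of the local inputs. -/
theorem tendsto_logOdds_div (h : IsTypical l θ₀ D d) {A : Matrix (Fin K) (Fin K) ℝ}
    (hA : IsLeftStochastic A) (hconn : IsStronglyConnected A) {v : Fin K → ℝ}
    (hv : IsPerronVector A v) {T : Fin H} (hne : (Finset.univ.erase T).Nonempty) (k : Fin K) :
    Tendsto (fun i : ℕ => logOdds A l T i k / ((i : ℝ) + 1)) atTop
      (𝓝 (∑ j, (-d j T - (Finset.univ.erase T).sup' hne fun τ => -d j τ) * v j)) := by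
  have hS : ∀ j, Tendsto (fun i : ℕ => cumulatedInput l T i j / i) atTop
      (𝓝 (-d j T - (Finset.univ.erase T).sup' hne fun τ => -d j τ)) := by
    intro j
    refine ((h.tendsto j T).sub (tendsto_log_sum_exp_div (a := fun i τ => logRatio l θ₀ i j τ) hne
      fun τ _ => h.tendsto j τ)).congr fun i => ?_
    rw [h.cumulatedInput_eq hne, sub_div]
  -- The scale is `i + 1` rather than `i` because `w` must be positive at time zero too.
  have h₁ := hv.tendsto_diffusion hA hconn (y := logOdds A l T) (S := cumulatedInput l T) rfl
    (fun i => rfl) (w := fun i => (i : ℝ) + 1)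
    (fun i j hij => by have : (i : ℝ) ≤ j := by exact_mod_cast hij
                       simpa using this)
    (fun i => by positivity) (fun j => tendsto_increment_div (hS j)) k
  have h₂ : Tendsto (fun i : ℕ => (cumulatedInput l T i ⬝ᵥ v) / ((i : ℝ) + 1)) atTop
      (𝓝 (∑ j, (-d j T - (Finset.univ.erase T).sup' hne fun τ => -d j τ) * v j)) := by
    have h₃ : ∀ j, Tendsto (fun i : ℕ => cumulatedInput l T i j / ((i : ℝ) + 1) * v j) atTop
        (𝓝 ((-d j T - (Finset.univ.erase T).sup' hne fun τ => -d j τ) * v j)) := by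
      intro j
      refine Tendsto.mul_const _ ?_
      have := (hS j).mul (tendsto_natCast_div_add_atTop (1 : ℝ))
      rw [mul_one] at this
      refine this.congr' ?_
      filter_upwards [eventually_gt_atTop 0] with i hi
      have hi' : (0 : ℝ) < i := by exact_mod_cast hi
      field_simp
    refine (tendsto_finsetSum Finset.univ fun j _ => h₃ j).congr fun i => ?_
    simp only [dotProduct, Finset.sum_div]
    exact Finset.sum_congr rfl fun j _ => by ring
  have h₄ := h₁.add h₂
  rw [zero_add] at h₄
  refine h₄.congr fun i => ?_
  ring

/-- The true hypothesis is among the competitors of `T`, so their sum has rate zero and each agent's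
input has slope `-d j T ≤ 0`. One agent that distinguishes `T` makes the Perron average negative, as
all entries of `v` are positive. -/
theorem tendsto_logOdds_atBot (h : IsTypical l θ₀ D d) {A : Matrix (Fin K) (Fin K) ℝ}
    (hA : IsLeftStochastic A) (hconn : IsStronglyConnected A) {T : Fin H} (hT : T ≠ θ₀)
    (hD : ∃ k, T ∈ D k) (k : Fin K) : Tendsto (fun i => logOdds A l T i k) atTop atBot := by
  obtain ⟨v, hv⟩ := hA.exists_isPerronVector hconn
  have hmem : θ₀ ∈ Finset.univ.erase T := Finset.mem_erase.2 ⟨hT.symm, Finset.mem_univ _⟩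
  have hne : (Finset.univ.erase T).Nonempty := ⟨θ₀, hmem⟩
  have hlim := h.tendsto_logOdds_div hA hconn hv hne k
  have hsup : ∀ j, ((Finset.univ.erase T).sup' hne fun τ => -d j τ) = 0 := by
    intro j
    refine le_antisymm (Finset.sup'_le hne _ fun τ _ => neg_nonpos.2 (h.rate_nonneg j τ)) ?_
    have := Finset.le_sup' (fun τ => -d j τ) hmem
    rwa [h.rate_zero j θ₀ (h.not_mem j), neg_zero] at this
  simp only [hsup, sub_zero] at hlim
  have hpos : 0 < -∑ j, -d j T * v j := by
    obtain ⟨j, hj⟩ := hD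
    rw [← Finset.sum_neg_distrib]
    refine Finset.sum_pos' (fun j _ => ?_) ⟨j, Finset.mem_univ j, ?_⟩
    · have := mul_nonneg (h.rate_nonneg j T) (hv.2.2 j).le
      linarith
    · have := mul_pos (h.rate_pos j T hj) (hv.2.2 j)
      linarith
  rw [← tendsto_neg_atTop_iff]
  refine tendsto_atTop_of_tendsto_div hpos (hlim.neg.congr fun i => ?_)
  ring

/-- For an agent that distinguishes every wrong hypothesis all competitors of `θ₀` decay
exponentially, so its input has positive slope. The slopes of the other agents are nonnegative and
cannot offset it. -/
theorem tendsto_logOdds_atTop (h : IsTypical l θ₀ D d) {A : Matrix (Fin K) (Fin K) ℝ}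
    (hA : IsLeftStochastic A) (hconn : IsStronglyConnected A)
    (hne : (Finset.univ.erase θ₀).Nonempty)
    (hD : ∃ k, Finset.univ.erase θ₀ \ D k = ∅) (k : Fin K) :
    Tendsto (fun i => logOdds A l θ₀ i k) atTop atTop := by
  obtain ⟨v, hv⟩ := hA.exists_isPerronVector hconn
  refine tendsto_atTop_of_tendsto_div ?_ (h.tendsto_logOdds_div hA hconn hv hne k)
  obtain ⟨j, hj⟩ := hD
  refine Finset.sum_pos' (fun j _ => ?_) ⟨j, Finset.mem_univ j, ?_⟩
  · refine mul_nonneg ?_ (hv.2.2 j).le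
    rw [h.rate_zero j θ₀ (h.not_mem j), neg_zero, zero_sub, neg_nonneg]
    exact Finset.sup'_le hne _ fun τ _ => neg_nonpos.2 (h.rate_nonneg j τ)
  · refine mul_pos ?_ (hv.2.2 j)
    rw [h.rate_zero j θ₀ (h.not_mem j), neg_zero, zero_sub, neg_pos, Finset.sup'_lt_iff]
    intro τ hτ
    exact neg_neg_of_pos (h.rate_pos j τ (Finset.sdiff_eq_empty_iff_subset.1 hj hτ))

/-- Here the inputs themselves converge, so their increments vanish and the diffusion lemma applies
with `w = 1`, giving a limit rather than a growth rate. -/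
theorem tendsto_logOdds (h : IsTypical l θ₀ D d) {A : Matrix (Fin K) (Fin K) ℝ}
    (hA : IsLeftStochastic A) (hconn : IsStronglyConnected A) {v : Fin K → ℝ}
    (hv : IsPerronVector A v)
    (hD : ∀ k, (Finset.univ.erase θ₀ \ D k).Nonempty) (k : Fin K) :
    Tendsto (fun i => logOdds A l θ₀ i k) atTop
      (𝓝 (-Real.log (confusionAverage (fun k => Finset.univ.erase θ₀ \ D k) v))) := by
  have hne : (Finset.univ.erase θ₀).Nonempty := (hD k).mono Finset.sdiff_subset
  have hc : ∀ k, (0 : ℝ) < (Finset.univ.erase θ₀ \ D k).card :=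
    fun k => by exact_mod_cast (hD k).card_pos
  have hS : ∀ j, Tendsto (fun i : ℕ => cumulatedInput l θ₀ i j) atTop
      (𝓝 (-Real.log (Finset.univ.erase θ₀ \ D j).card)) := by
    intro j
    have := (((h.tendsto_exp_logRatio j θ₀).div
      (h.tendsto_sum_exp_logRatio j (Finset.univ.erase θ₀)) (hc j).ne')).log
      (by rw [if_neg (h.not_mem j)]; exact (div_pos one_pos (hc j)).ne')
    rw [if_neg (h.not_mem j), one_div, Real.log_inv] at this
    refine this.congr fun i => ?_
    rw [cumulatedInput, h.share_eq]
    rfl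
  have h₁ := hv.tendsto_diffusion hA hconn (y := logOdds A l θ₀) (S := cumulatedInput l θ₀) rfl
    (fun i => rfl) (w := fun _ => 1) monotone_const (fun _ => one_pos)
    (fun j => by simpa using ((hS j).comp (tendsto_add_atTop_nat 1)).sub (hS j)) k
  have h₂ := tendsto_finsetSum Finset.univ fun j _ => (hS j).mul_const (v j)
  have h₃ := h₁.add h₂
  have hlog : Real.log (confusionAverage (fun k => Finset.univ.erase θ₀ \ D k) v) =
      ∑ j, Real.log (Finset.univ.erase θ₀ \ D j).card * v j := by
    rw [confusionAverage, Real.log_prod fun j _ => (Real.rpow_pos_of_pos (hc j) _).ne']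
    exact Finset.sum_congr rfl fun j _ => by rw [Real.log_rpow (hc j), mul_comm]
  rw [hlog, ← Finset.sum_neg_distrib]
  simp only [zero_add, neg_mul] at h₃
  refine h₃.congr fun i => ?_
  simp only [dotProduct, div_one]
  ring

end IsTypical

/-! ### Limits of the beliefs along typical sequences -/

theorem tendsto_odds_div_one_add {y : ℕ → ℝ} (hy : Tendsto y atTop atTop) :
    Tendsto (fun i => Real.exp (y i) / (1 + Real.exp (y i))) atTop (𝓝 1) := by
  have h₁ : Tendsto (fun i => 1 / (1 + Real.exp (-y i))) atTop (𝓝 (1 / (1 + 0))) :=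
    tendsto_const_nhds.div (tendsto_const_nhds.add
      (Real.tendsto_exp_atBot.comp (tendsto_neg_atBot_iff.2 hy))) (by norm_num)
  simp only [add_zero, div_one] at h₁
  refine h₁.congr fun i => ?_
  have := Real.exp_pos (y i)
  rw [Real.exp_neg]
  field_simp
  ring

theorem tendsto_one_div_one_add_odds {y : ℕ → ℝ} (hy : Tendsto y atTop atTop) :
    Tendsto (fun i => 1 / (1 + Real.exp (y i))) atTop (𝓝 0) :=
  tendsto_const_nhds.div_atTop
    (tendsto_atTop_add_const_left _ _ (Real.tendsto_exp_atTop.comp hy))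

section BeliefLimits

variable {K H : ℕ} {l : ℕ → Fin K → Fin H → ℝ} {θ₀ : Fin H} {D : Fin K → Finset (Fin H)}
  {d : Fin K → Fin H → ℝ} {A : Matrix (Fin K) (Fin K) ℝ} {b : ℕ → Fin K → Fin H → ℝ}

/-- The beliefs along a typical sequence of likelihoods when a wrong hypothesis is transmitted. -/
theorem IsTypical.tendsto_belief_of_ne (h : IsTypical l θ₀ D d) (hA : IsLeftStochastic A)
    (hconn : IsStronglyConnected A) {T : Fin H} (hT : T ≠ θ₀) (hD : ∃ k, T ∈ D k)
    (hb0 : b 0 = fun _ _ => 1 / (H : ℝ)) (hb : ∀ i, b (i + 1) = beliefStep A T (l i) (b i))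
    (k : Fin K) (θ : Fin H) :
    Tendsto (fun i => b i k θ) atTop (𝓝 (if θ = T ∨ θ ∈ D k then 0 else
      1 / ((Finset.univ.erase T \ D k).card : ℝ))) := by
  have hmem : θ₀ ∈ Finset.univ.erase T := Finset.mem_erase.2 ⟨hT.symm, Finset.mem_univ _⟩
  have hy := Real.tendsto_exp_atBot.comp (h.tendsto_logOdds_atBot hA hconn hT hD k)
  have hy1 : Tendsto (fun i => 1 + Real.exp (logOdds A l T i k)) atTop (𝓝 (1 + 0)) :=
    tendsto_const_nhds.add hy
  simp only [belief_eq_oddsBelief hA ⟨θ₀, hmem⟩ h.pos hb0 hb]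
  by_cases hθ : θ = T
  · subst hθ
    simp only [oddsBelief_self, true_or, if_true]
    have := hy.div hy1 (by norm_num)
    rwa [zero_div] at this
  · simp only [oddsBelief_of_ne hθ, hθ, false_or]
    have := (h.tendsto_share k (s := Finset.univ.erase T)
      ⟨θ₀, Finset.mem_sdiff.2 ⟨hmem, h.not_mem k⟩⟩ θ).div hy1 (by norm_num)
    rw [add_zero, div_one, ite_div, zero_div] at this
    exact this

/-- The beliefs along a typical sequence of likelihoods when the true hypothesis is
transmitted. -/
theorem IsTypical.tendsto_belief_self (h : IsTypical l θ₀ D d) (hA : IsLeftStochastic A)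
    (hconn : IsStronglyConnected A) {v : Fin K → ℝ} (hv : IsPerronVector A v)
    (hb0 : b 0 = fun _ _ => 1 / (H : ℝ)) (hb : ∀ i, b (i + 1) = beliefStep A θ₀ (l i) (b i))
    {J : ℝ} (hJ : J = confusionAverage (fun k => Finset.univ.erase θ₀ \ D k) v)
    (k : Fin K) (θ : Fin H) :
    Tendsto (fun i => b i k θ) atTop (𝓝 (if θ = θ₀ then 1 / (1 + J) else if θ ∈ D k then 0 else
      J / ((Finset.univ.erase θ₀ \ D k).card : ℝ) * (1 / (1 + J)))) := by
  -- If some agent confuses nothing with `θ₀`, then `J = 0` and the odds diverge; otherwise `J > 0`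
  -- and they converge to `J⁻¹`.
  by_cases hex : ∃ k, Finset.univ.erase θ₀ \ D k = ∅
  · have hJ0 : J = 0 := by
      obtain ⟨j, hj⟩ := hex
      rw [hJ, confusionAverage]
      refine Finset.prod_eq_zero (Finset.mem_univ j) ?_
      rw [hj, Finset.card_empty, Nat.cast_zero, Real.zero_rpow (hv.2.2 j).ne']
    rw [hJ0]
    simp only [add_zero, div_one, zero_div, zero_mul, ite_self]
    rcases Finset.eq_empty_or_nonempty (Finset.univ.erase θ₀) with hemp | hne
    · have hall : ∀ θ, θ = θ₀ := fun θ => by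
        by_contra hθ
        exact Finset.notMem_empty θ (hemp ▸ Finset.mem_erase.2 ⟨hθ, Finset.mem_univ θ⟩)
      rw [hall θ, if_pos rfl]
      simp only [belief_eq_one hall h.pos hb0 hb, tendsto_const_nhds]
    · have hy := h.tendsto_logOdds_atTop hA hconn hne hex k
      simp only [belief_eq_oddsBelief hA hne h.pos hb0 hb]
      split_ifs with hθ
      · subst hθ
        simpa only [oddsBelief_self] using tendsto_odds_div_one_add hy
      · simp only [oddsBelief_of_ne hθ]
        have hP := jointLikelihood_pos h.pos
        -- The share of `θ` need not be tracked: it is at most one, and the residual mass it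
        -- multiplies vanishes.
        refine squeeze_zero (fun i => ?_) (fun i => ?_) (tendsto_one_div_one_add_odds hy)
        · have := Finset.sum_nonneg fun τ (_ : τ ∈ Finset.univ.erase θ₀) => (hP i k τ).le
          have := hP i k θ
          positivity
        · refine div_le_div_of_nonneg_right (div_le_one_of_le₀ ?_ ?_) (by positivity)
          · exact Finset.single_le_sum (f := fun τ => jointLikelihood l i k τ)
              (fun τ _ => (hP i k τ).le) (Finset.mem_erase.2 ⟨hθ, Finset.mem_univ θ⟩)
          · exact Finset.sum_nonneg fun τ _ => (hP i k τ).le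
  · simp only [not_exists, ← ne_eq, ← Finset.nonempty_iff_ne_empty] at hex
    have hne : (Finset.univ.erase θ₀).Nonempty := (hex k).mono Finset.sdiff_subset
    have hJ0 : 0 < J := by
      rw [hJ, confusionAverage]
      exact Finset.prod_pos fun j _ => Real.rpow_pos_of_pos (by exact_mod_cast (hex j).card_pos) _
    have hy := (h.tendsto_logOdds hA hconn hv hex k).rexp
    rw [← hJ, Real.exp_neg, Real.exp_log hJ0] at hy
    have hy1 : Tendsto (fun i => 1 + Real.exp (logOdds A l θ₀ i k)) atTop (𝓝 (1 + J⁻¹)) :=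
      tendsto_const_nhds.add hy
    simp only [belief_eq_oddsBelief hA hne h.pos hb0 hb]
    by_cases hθ : θ = θ₀
    · subst hθ
      simp only [oddsBelief_self, if_true]
      have hlim : J⁻¹ / (1 + J⁻¹) = 1 / (1 + J) := by
        field_simp
        ring
      rw [← hlim]
      exact hy.div hy1 (by positivity)
    · simp only [oddsBelief_of_ne hθ, hθ, if_false]
      have hlim : (if θ ∈ D k then 0 else 1) / ((Finset.univ.erase θ₀ \ D k).card : ℝ) / (1 + J⁻¹) =
          if θ ∈ D k then 0 else J / ((Finset.univ.erase θ₀ \ D k).card : ℝ) * (1 / (1 + J)) := by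
        have hc : (0 : ℝ) < (Finset.univ.erase θ₀ \ D k).card := by
          exact_mod_cast (hex k).card_pos
        split_ifs
        · simp
        · field_simp
          ring
      rw [← hlim]
      exact (h.tendsto_share k (hex k) θ).div hy1 (by positivity)

end BeliefLimits

/-! ### Likelihood ratios -/

section LikelihoodRatio

variable {H : ℕ} {X : Type*} [MeasurableSpace X] {ν : Measure X} {f : Fin H → X → ℝ}

theorem IsDensityFamily.isProbabilityMeasure (hf : IsDensityFamily ν f) (θ : Fin H) :
    IsProbabilityMeasure (densityLaw ν (f θ)) :=
  ⟨by rw [densityLaw, withDensity_apply _ MeasurableSet.univ, Measure.restrict_univ, (hf θ).2.2]⟩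

theorem IsDensityFamily.ae_pos (hf : IsDensityFamily ν f) (θ : Fin H) :
    ∀ᵐ x ∂densityLaw ν (f θ), 0 < f θ x := by
  rw [densityLaw, ae_withDensity_iff (hf θ).1.ennreal_ofReal]
  exact Eventually.of_forall fun x hx => ENNReal.ofReal_pos.1 (pos_iff_ne_zero.2 hx)

/-- The chain rule for Radon–Nikodym derivatives through `ν`, divided by the density of `θ`, which
is positive almost surely under `θ₀` by absolute continuity. -/
theorem IsDensityFamily.llr_ae_eq [SigmaFinite ν] (hf : IsDensityFamily ν f) {θ₀ θ : Fin H}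
    (hac : densityLaw ν (f θ₀) ≪ densityLaw ν (f θ)) :
    llr (densityLaw ν (f θ₀)) (densityLaw ν (f θ)) =ᵐ[densityLaw ν (f θ₀)]
      fun x => Real.log (f θ₀ x / f θ x) := by
  have := hf.isProbabilityMeasure θ₀
  have := hf.isProbabilityMeasure θ
  have habs : densityLaw ν (f θ₀) ≪ ν := withDensity_absolutelyContinuous _ _
  have h₁ := habs (Measure.rnDeriv_mul_rnDeriv (κ := ν) hac)
  have h₂ := habs (Measure.rnDeriv_withDensity ν (hf θ₀).1.ennreal_ofReal)
  have h₃ := habs (Measure.rnDeriv_withDensity ν (hf θ).1.ennreal_ofReal)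
  filter_upwards [h₁, h₂, h₃, hf.ae_pos θ₀, hac (hf.ae_pos θ)] with x h₁ h₂ h₃ h₄ h₅
  simp only [densityLaw, Pi.mul_apply] at h₁ ⊢
  rw [h₂, h₃] at h₁
  have h₆ := congrArg ENNReal.toReal h₁
  rw [ENNReal.toReal_mul, ENNReal.toReal_ofReal h₄.le, ENNReal.toReal_ofReal h₅.le] at h₆
  rw [llr, ← h₆, mul_div_cancel_right₀ _ h₅.ne']

theorem IsDensityFamily.eq_of_klDiv_eq_zero [SigmaFinite ν] (hf : IsDensityFamily ν f)
    {θ₀ θ : Fin H}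
    (h : InformationTheory.klDiv (densityLaw ν (f θ₀)) (densityLaw ν (f θ)) = 0) :
    ∀ᵐ x ∂densityLaw ν (f θ₀), f θ x = f θ₀ x := by
  have := hf.isProbabilityMeasure θ₀
  have := hf.isProbabilityMeasure θ
  rw [InformationTheory.klDiv_eq_zero_iff] at h
  have heq := (withDensity_eq_iff_of_sigmaFinite (hf θ₀).1.ennreal_ofReal.aemeasurable
    (hf θ).1.ennreal_ofReal.aemeasurable).1 h
  have habs : densityLaw ν (f θ₀) ≪ ν := withDensity_absolutelyContinuous _ _
  filter_upwards [habs heq] with x hx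
  exact ((ENNReal.ofReal_eq_ofReal_iff ((hf θ₀).2.1 x) ((hf θ).2.1 x)).1 hx).symm

/-- The strong law of large numbers for logarithmic likelihood ratios. -/
theorem IsDensityFamily.ae_tendsto_logRatio [SigmaFinite ν] (hf : IsDensityFamily ν f)
    {θ₀ θ : Fin H}
    (hKL : InformationTheory.klDiv (densityLaw ν (f θ₀)) (densityLaw ν (f θ)) < ⊤)
    {Ω : Type*} [MeasurableSpace Ω] {P : Measure Ω} {ξ : ℕ → Ω → X}
    (hξ : ∀ i, Measurable (ξ i)) (hlaw : ∀ i, P.map (ξ i) = densityLaw ν (f θ₀))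
    (hindep : iIndepFun ξ P) :
    ∀ᵐ ω ∂P, Tendsto (fun i : ℕ =>
      (∑ j ∈ Finset.range i, Real.log (f θ (ξ j ω) / f θ₀ (ξ j ω))) / i) atTop
      (𝓝 (-(InformationTheory.klDiv (densityLaw ν (f θ₀)) (densityLaw ν (f θ))).toReal)) := by
  have := hf.isProbabilityMeasure θ₀
  have := hf.isProbabilityMeasure θ
  -- Finite divergence provides both absolute continuity and the integrability that the strong law
  -- needs.
  obtain ⟨hac, hint⟩ := InformationTheory.klDiv_ne_top_iff.1 hKL.ne
  set g : X → ℝ := fun x => Real.log (f θ x / f θ₀ x) with hg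
  have hgm : Measurable g := ((hf θ).1.div (hf θ₀).1).log
  have hgl : g =ᵐ[densityLaw ν (f θ₀)]
      fun x => -llr (densityLaw ν (f θ₀)) (densityLaw ν (f θ)) x := by
    filter_upwards [hf.llr_ae_eq hac] with x hx
    rw [hx, ← Real.log_inv, inv_div]
  have hgint : Integrable g (P.map (ξ 0)) := by
    rw [hlaw]
    exact hint.neg.congr hgl.symm
  have hmean : ∫ ω, (g ∘ ξ 0) ω ∂P =
      -(InformationTheory.klDiv (densityLaw ν (f θ₀)) (densityLaw ν (f θ))).toReal := by
    -- Both laws have mass one, so the divergence is the plain integral of the log-likelihood ratio.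
    rw [InformationTheory.toReal_klDiv_of_measure_eq hac (by simp), ← integral_neg,
      ← integral_congr_ae hgl, ← hlaw 0, integral_map (hξ 0).aemeasurable
      hgm.aestronglyMeasurable]
    rfl
  have hslln := strong_law_ae_real (μ := P) (fun i => g ∘ ξ i) (hgint.comp_measurable (hξ 0))
    (fun i j hij => (hindep.indepFun hij).comp hgm hgm)
    (fun i => IdentDistrib.comp ⟨(hξ i).aemeasurable, (hξ 0).aemeasurable,
      (hlaw i).trans (hlaw 0).symm⟩ hgm)
  rw [hmean] at hslln
  exact hslln

end LikelihoodRatio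

/-! ### From random observations to typical sequences -/

theorem mem_distinguishable {H : ℕ} {X : Type*} [MeasurableSpace X] {ν : Measure X}
    {f : Fin H → X → ℝ} {θ₀ θ : Fin H} : θ ∈ distinguishable ν f θ₀ ↔
      InformationTheory.klDiv (densityLaw ν (f θ₀)) (densityLaw ν (f θ)) ≠ 0 := by
  simp [distinguishable]

theorem IsDensityFamily.not_mem_distinguishable {H : ℕ} {X : Type*} [MeasurableSpace X]
    {ν : Measure X} {f : Fin H → X → ℝ} (hf : IsDensityFamily ν f) (θ₀ : Fin H) :
    θ₀ ∉ distinguishable ν f θ₀ := by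
  have := hf.isProbabilityMeasure θ₀
  rw [mem_distinguishable, not_not, InformationTheory.klDiv_self]

theorem indistinguishable_eq_sdiff {H : ℕ} {X : Type*} [MeasurableSpace X] (ν : Measure X)
    (f : Fin H → X → ℝ) (θ₀ : Fin H) :
    indistinguishable ν f θ₀ = Finset.univ.erase θ₀ \ distinguishable ν f θ₀ := by
  ext θ
  simp [indistinguishable, distinguishable]

theorem IsDensityFamily.insert_indistinguishable_eq_sdiff {H : ℕ} {X : Type*} [MeasurableSpace X]
    {ν : Measure X} {f : Fin H → X → ℝ} (hf : IsDensityFamily ν f) {θ₀ T : Fin H} (hT : T ≠ θ₀) :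
    {θ₀} ∪ (indistinguishable ν f θ₀ \ {T}) =
      Finset.univ.erase T \ distinguishable ν f θ₀ := by
  rw [indistinguishable_eq_sdiff]
  ext θ
  by_cases h : θ = θ₀
  · subst h
    simp [hf.not_mem_distinguishable θ, hT.symm]
  · simp [h, and_comm]

/-- Almost surely, the likelihoods of the observations form a typical sequence. -/
theorem ae_isTypical {K H : ℕ} {X : Fin K → Type*} [∀ k, MeasurableSpace (X k)]
    (ν : (k : Fin K) → Measure (X k)) [∀ k, SigmaFinite (ν k)]
    (L : (k : Fin K) → Fin H → X k → ℝ) (hL : ∀ k, IsDensityFamily (ν k) (L k))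
    (θ₀ : Fin H) (hKL : ∀ k θ,
      InformationTheory.klDiv (densityLaw (ν k) (L k θ₀)) (densityLaw (ν k) (L k θ)) < ⊤)
    {Ω : Type*} [MeasurableSpace Ω] {P : Measure Ω}
    {ξ : (k : Fin K) → ℕ → Ω → X k} (hξ : ∀ k i, Measurable (ξ k i))
    (hlaw : ∀ k i, P.map (ξ k i) = densityLaw (ν k) (L k θ₀))
    (hindep : iIndepFun (fun (i : ℕ) (ω : Ω) (k : Fin K) => ξ k i ω) P) :
    ∀ᵐ ω ∂P, IsTypical (fun i k θ => L k θ (ξ k i ω)) θ₀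
      (fun k => distinguishable (ν k) (L k) θ₀) fun k θ =>
      (InformationTheory.klDiv (densityLaw (ν k) (L k θ₀)) (densityLaw (ν k) (L k θ))).toReal := by
  have hpull : ∀ k i (p : X k → Prop), (∀ᵐ x ∂densityLaw (ν k) (L k θ₀), p x) →
      ∀ᵐ ω ∂P, p (ξ k i ω) := by
    intro k i p hp
    rw [← hlaw k i] at hp
    exact ae_of_ae_map (hξ k i).aemeasurable hp
  have hpos : ∀ᵐ ω ∂P, ∀ i k θ, 0 < L k θ (ξ k i ω) := by
    simp only [ae_all_iff]
    intro i k θ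
    exact hpull k i _ ((InformationTheory.klDiv_ne_top_iff.1 (hKL k θ).ne).1 ((hL k).ae_pos θ))
  have heq : ∀ᵐ ω ∂P, ∀ i k θ, θ ∉ distinguishable (ν k) (L k) θ₀ →
      L k θ (ξ k i ω) = L k θ₀ (ξ k i ω) := by
    simp only [ae_all_iff]
    intro i k θ hθ
    rw [mem_distinguishable, not_not] at hθ
    exact hpull k i _ ((hL k).eq_of_klDiv_eq_zero hθ)
  -- The strong law is applied to one agent at a time, by projecting the joint observations, so
  -- dependence across agents is harmless.
  have hlim := ae_all_iff.2 fun k => ae_all_iff.2 fun θ =>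
    (hL k).ae_tendsto_logRatio (hKL k θ) (hξ k) (hlaw k)
      (hindep.comp (fun _ x => x k) fun _ => measurable_pi_apply k)
  filter_upwards [hpos, heq, hlim] with ω h₁ h₂ h₃
  refine ⟨h₁, fun k => (hL k).not_mem_distinguishable θ₀, h₂, fun k θ hθ => ?_, fun k θ hθ => ?_,
    h₃⟩
  · exact ENNReal.toReal_pos (mem_distinguishable.1 hθ) (hKL k θ).ne
  · rw [mem_distinguishable, not_not] at hθ
    rw [hθ, ENNReal.toReal_zero]

/-! ### Almost sure limits of the beliefs -/

theorem corollary1 {K H : ℕ}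
    -- the network
    (A : Matrix (Fin K) (Fin K) ℝ) (hA : IsLeftStochastic A) (hconn : IsStronglyConnected A)
    -- the likelihood models of the agents
    {X : Fin K → Type*} [∀ k, MeasurableSpace (X k)]
    (ν : (k : Fin K) → Measure (X k)) [∀ k, SigmaFinite (ν k)]
    (L : (k : Fin K) → Fin H → X k → ℝ) (hL : ∀ k, IsDensityFamily (ν k) (L k))
    (hKL : ∀ k θ θ',
      InformationTheory.klDiv (densityLaw (ν k) (L k θ)) (densityLaw (ν k) (L k θ')) < ⊤)
    -- the true and the transmitted hypothesis
    (θ₀ θTX : Fin H)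
    (hident : ∀ θ, θ ≠ θ₀ → ∃ k, θ ∈ distinguishable (ν k) (L k) θ₀)
    (hmix : ∀ k, TrueModelNotMixture (ν k) (L k) θ₀)
    -- the observations: distributed according to the true model, independent over time,
    -- with arbitrary dependence across the agents
    {Ω : Type*} [MeasurableSpace Ω] (P : Measure Ω) [IsProbabilityMeasure P]
    (ξ : (k : Fin K) → ℕ → Ω → X k) (hξ : ∀ k i, Measurable (ξ k i))
    (hlaw : ∀ k i, P.map (ξ k i) = densityLaw (ν k) (L k θ₀))
    (hindep : iIndepFun (fun (i : ℕ) (ω : Ω) (k : Fin K) => ξ k i ω) P)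
    -- the beliefs, started from uniform initial beliefs
    (μ : ℕ → Fin K → Fin H → Ω → ℝ)
    (hμ : ∀ i k θ ω, μ i k θ ω =
      belief A L θTX (fun _ _ => 1 / (H : ℝ)) (fun k' j => ξ k' j ω) i k θ) :
    (∃! v : Fin K → ℝ, IsPerronVector A v) ∧
    (θTX ≠ θ₀ → ∀ k,
      (∀ᵐ ω ∂P, Tendsto (fun i => μ i k θTX ω) atTop (𝓝 0)) ∧
      (∀ θ ∈ distinguishable (ν k) (L k) θ₀ \ {θTX},
        ∀ᵐ ω ∂P, Tendsto (fun i => μ i k θ ω) atTop (𝓝 0)) ∧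
      (∀ θ ∈ {θ₀} ∪ (indistinguishable (ν k) (L k) θ₀ \ {θTX}),
        ∀ᵐ ω ∂P, Tendsto (fun i => μ i k θ ω) atTop
          (𝓝 (1 / (({θ₀} ∪ (indistinguishable (ν k) (L k) θ₀ \ {θTX})).card : ℝ))))) ∧
    (θTX = θ₀ → ∀ v : Fin K → ℝ, IsPerronVector A v →
      ∀ J : ℝ, J = confusionAverage (fun k => indistinguishable (ν k) (L k) θ₀) v → ∀ k,
      (∀ᵐ ω ∂P, Tendsto (fun i => μ i k θ₀ ω) atTop (𝓝 (1 / (1 + J)))) ∧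
      (∀ θ ∈ distinguishable (ν k) (L k) θ₀,
        ∀ᵐ ω ∂P, Tendsto (fun i => μ i k θ ω) atTop (𝓝 0)) ∧
      (∀ θ ∈ indistinguishable (ν k) (L k) θ₀,
        ∀ᵐ ω ∂P, Tendsto (fun i => μ i k θ ω) atTop
          (𝓝 (J / ((indistinguishable (ν k) (L k) θ₀).card : ℝ) * (1 / (1 + J)))))) := by
  have htyp := ae_isTypical ν L hL θ₀ (fun k θ => hKL k θ₀ θ) hξ hlaw hindep
  refine ⟨hA.existsUnique_isPerronVector hconn, fun hT k => ?_, fun hT v hv J hJ k => ?_⟩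
  · have hlim : ∀ θ, ∀ᵐ ω ∂P, Tendsto (fun i => μ i k θ ω) atTop
        (𝓝 (if θ = θTX ∨ θ ∈ distinguishable (ν k) (L k) θ₀ then 0 else
          1 / ((Finset.univ.erase θTX \ distinguishable (ν k) (L k) θ₀).card : ℝ))) := by
      intro θ
      filter_upwards [htyp] with ω hω
      simp only [hμ]
      exact hω.tendsto_belief_of_ne hA hconn hT (hident θTX hT) rfl (fun _ => rfl) k θ
    refine ⟨?_, fun θ hθ => ?_, fun θ hθ => ?_⟩
    · simpa only [true_or, if_true] using hlim θTX
    · simpa only [(Finset.mem_sdiff.1 hθ).1, or_true, if_true] using hlim θ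
    · rw [(hL k).insert_indistinguishable_eq_sdiff hT] at hθ ⊢
      obtain ⟨h₁, h₂⟩ := Finset.mem_sdiff.1 hθ
      simpa only [Finset.ne_of_mem_erase h₁, h₂, or_self, if_false] using hlim θ
  · subst hT
    simp only [indistinguishable_eq_sdiff] at hJ ⊢
    have hlim : ∀ θ, ∀ᵐ ω ∂P, Tendsto (fun i => μ i k θ ω) atTop
        (𝓝 (if θ = θTX then 1 / (1 + J) else if θ ∈ distinguishable (ν k) (L k) θTX then 0 else
          J / ((Finset.univ.erase θTX \ distinguishable (ν k) (L k) θTX).card : ℝ) *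
            (1 / (1 + J)))) := by
      intro θ
      filter_upwards [htyp] with ω hω
      simp only [hμ]
      exact hω.tendsto_belief_self hA hconn hv rfl (fun _ => rfl) hJ k θ
    refine ⟨?_, fun θ hθ => ?_, fun θ hθ => ?_⟩
    · simpa only [if_true] using hlim θTX
    · have hne : θ ≠ θTX := fun h => (hL k).not_mem_distinguishable θTX (h ▸ hθ)
      simpa only [hne, hθ, if_true, if_false] using hlim θ
    · obtain ⟨h₁, h₂⟩ := Finset.mem_sdiff.1 hθ
      simpa only [Finset.ne_of_mem_erase h₁, h₂, if_false] using hlim θ
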